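/- Let $M$ be a smooth (Hausdorff) $n$-dimensional manifold, $w$ a Poisson bivector field on $M$, and $\nabla$ a smooth linear connection on $TM$. For a covector $\alpha$ let $\alpha^\sharp$ be the vector with $\beta(\alpha^\sharp)=w(\alpha,\beta)$ for all $\beta$, and let $\{f,g\}_w=w(df,dg)$. Let $D$ be the contravariant derivative induced by $\nabla$, $D_\alpha X=\nabla_{\alpha^\sharp}X$ and $D_\alpha\beta=\nabla_{\alpha^\sharp}\beta$ for vector fields $X$ and $1$-forms $\alpha,\beta$. For a vector field $X$ let ${}^sDX$ be the symmetric tensor field ${}^sDX(\alpha,\beta)=\frac12\big(\beta(D_\alpha X)+\alpha(D_\beta X)\big)$, and let $\langle\cdot,\cdot\rangle$ be the Schouten–Nijenhuis bracket of symmetric contravariant tensor fields, so that $\langle X,Y\rangle=[X,Y]$ and $\langle X,Q\rangle=-\langle Q,X\rangle=\mathcal L_XQ$ for vector fields $X,Y$ and symmetric $2$-contravariant $Q$. On the cotangent bundle $\pi:T^*M\to M$ with natural coordinates $(x^i,p_i)$, functions $f$ on $M$ are identified with $f\circ\pi$, and we write $m(X)=X^ip_i$ for a vector field $X$ and $s(Q)=Q^{ij}p_ip_j$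 for a $2$-contravariant tensor field $Q$. Let $W_0=\frac{\partial}{\partial p_i}\wedge\frac{\partial}{\partial x^i}$ be the canonical Poisson bivector, let $K$ be the vector field on $T^*M$ whose value at $\alpha\in T^*M$ is the $\nabla$-horizontal lift to $\alpha$ of $\alpha^\sharp$, and let $W_2=\frac12\mathcal L_KW_0$ be the graded $\nabla$-lift of $w$. For a bivector field $W$ on $T^*M$ write $\{F,G\}_W=W(dF,dG)$. Then $W_2$ is a smooth bivector field on $T^*M$, and the formula $$\bar D_\alpha\beta=D_\alpha\beta+\tfrac12(\nabla_{\cdot}w)(\alpha,\beta),\qquad (\nabla_\cdot w)(\alpha,\beta):X\mapsto(\nabla_Xw)(\alpha,\beta),$$ defines a contravariant derivative of $(M,w)$, acting on vector fields by the duality $\alpha^\sharp\langle\beta,X\rangle=\langle\bar D_\alpha\beta,X\rangle+\langle\beta,\bar D_\alpha X\rangle$. Consider, for a bivector field $W$ on $T^*M$, the relations (i) $\{f,g\}_{W}=\{f,g\}_w$ for all $f,g\in C^\infty(M)$; (ii) $\{m(X),f\}_{W}=-m(\bar D_{df}X)$ for all $f\in C^\infty(M)$ and all vector fields $X$ on $M$;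 (iii) $\{m(X),m(Y)\}_{W}=\frac12\,s\big({}^sD\langle X,Y\rangle-\langle{}^sDX,Y\rangle-\langle X,{}^sDY\rangle\big)$ for all vector fields $X,Y$ on $M$. The bivector field $W_2$ satisfies (i) and (iii). If moreover $\nabla$ is torsion-free, then $W_2$ is characterized by (i)–(iii): a bivector field $W$ on $T^*M$ satisfies (i), (ii) and (iii) if and only if $W=W_2$. -/

import Mathlib

open Bundle VectorField
open scoped Manifold ContDiff

noncomputable section

namespace GradedLift

section General

/-! ### Tensor fields on a finite-dimensional manifold `N`

All tensor fields are families indexed by the points of `N`; smoothness is imposed separately. -/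

variable {E : Type*} [NormedAddCommGroup E] [NormedSpace ℝ E]
  {H : Type*} [TopologicalSpace H] (I : ModelWithCorners ℝ E H)
  {N : Type*} [TopologicalSpace N] [ChartedSpace H N]

/-- The cotangent space of `N` at `x`. -/
abbrev Cotangent (x : N) : Type _ := TangentSpace I x →L[ℝ] ℝ

instance finiteDimensional_tangentSpace [FiniteDimensional ℝ E] (x : N) :
    FiniteDimensional ℝ (TangentSpace I x) := inferInstanceAs (FiniteDimensional ℝ E)

instance t2Space_tangentSpace (x : N) : T2Space (TangentSpace I x) :=
  inferInstanceAs (T2Space E)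

instance finiteDimensional_cotangent [FiniteDimensional ℝ E] (x : N) :
    FiniteDimensional ℝ (Cotangent I x) := inferInstanceAs (FiniteDimensional ℝ (E →L[ℝ] ℝ))

variable (N) in
/-- Vector fields on `N`. -/
abbrev VField : Type _ := ∀ x : N, TangentSpace I x

variable (N) in
/-- Differential 1-forms on `N`. -/
abbrev OneForm : Type _ := ∀ x : N, Cotangent I x

variable (N) in
/-- 2-contravariant tensor fields on `N`: at each point, a bilinear form on the cotangent space. -/
abbrev Tensor2 : Type _ := ∀ x : N, LinearMap.BilinForm ℝ (Cotangent I x)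

/-- A smooth real function on `N`. -/
def SmoothFun (f : N → ℝ) : Prop := ContMDiff I 𝓘(ℝ, ℝ) ∞ f

/-- The bracket `{F, G}_W = W(dF, dG)` of two functions. -/
def bracket (W : Tensor2 I N) (F G : N → ℝ) : N → ℝ :=
  fun x => W x (mvfderiv I F x) (mvfderiv I G x)

/-- `W` is a (smooth) bivector field: it is skew-symmetric and `W(dF, dG)` is smooth for all
smooth functions `F`, `G`. -/
structure IsBivectorField (W : Tensor2 I N) : Prop where
  skew : ∀ (x : N) (α β : Cotangent I x), W x α β = -W x β α
  smooth : ∀ F G : N → ℝ, SmoothFun I F → SmoothFun I G → SmoothFun I (bracket I W F G)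

/-- `w` is a Poisson structure: a bivector field whose bracket satisfies the Jacobi identity. -/
structure IsPoisson (w : Tensor2 I N) : Prop where
  bivector : IsBivectorField I w
  jacobi : ∀ f g h : N → ℝ, SmoothFun I f → SmoothFun I g → SmoothFun I h → ∀ x : N,
    bracket I w f (bracket I w g h) x + bracket I w g (bracket I w h f) x
      + bracket I w h (bracket I w f g) x = 0

section Linear

variable {V V' : Type*} [AddCommGroup V] [Module ℝ V] [TopologicalSpace V]
  [AddCommGroup V'] [Module ℝ V'] [TopologicalSpace V']

/-- Composition of covectors with a linear map `L : V → V'`. -/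
def precompose (L : V →L[ℝ] V') : (V' →L[ℝ] ℝ) →ₗ[ℝ] (V →L[ℝ] ℝ) where
  toFun a := a.comp L
  map_add' _ _ := rfl
  map_smul' _ _ := rfl

/-- The derivation of bilinear forms on `V*` given by an endomorphism `A` of `V`:
`(a, b) ↦ Q(a ∘ A, b) + Q(a, b ∘ A)`. -/
def actEnd (A : V →L[ℝ] V) (Q : LinearMap.BilinForm ℝ (V →L[ℝ] ℝ)) :
    LinearMap.BilinForm ℝ (V →L[ℝ] ℝ) :=
  Q.compLeft (precompose A) + Q.compRight (precompose A)

theorem actEnd_apply (A : V →L[ℝ] V) (Q : LinearMap.BilinForm ℝ (V →L[ℝ] ℝ))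
    (a b : V →L[ℝ] ℝ) : actEnd A Q a b = Q (a.comp A) b + Q a (b.comp A) := rfl

variable [IsTopologicalAddGroup V] [ContinuousSMul ℝ V] [FiniteDimensional ℝ V] [T2Space V]

/-- The vector `α^♯` of a covector `α`, defined by `β(α^♯) = B(α, β)` for all covectors `β`. -/
def sharp (B : LinearMap.BilinForm ℝ (V →L[ℝ] ℝ)) (α : V →L[ℝ] ℝ) : V :=
  (Module.evalEquiv ℝ V).symm
    (B α ∘ₗ (LinearMap.toContinuousLinearMap : (V →ₗ[ℝ] ℝ) ≃ₗ[ℝ] (V →L[ℝ] ℝ)).toLinearMap)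

theorem apply_sharp (B : LinearMap.BilinForm ℝ (V →L[ℝ] ℝ)) (α β : V →L[ℝ] ℝ) :
    β (sharp B α) = B α β :=
  (Module.apply_evalEquiv_symm_apply ℝ V (β : V →ₗ[ℝ] ℝ) _).trans
    (congrArg (B α) (ContinuousLinearMap.ext fun _ => rfl))

theorem sharp_add (B : LinearMap.BilinForm ℝ (V →L[ℝ] ℝ)) (α α' : V →L[ℝ] ℝ) :
    sharp B (α + α') = sharp B α + sharp B α' := by
  simp only [sharp, map_add, LinearMap.add_comp]

theorem sharp_smul (B : LinearMap.BilinForm ℝ (V →L[ℝ] ℝ)) (c : ℝ) (α : V →L[ℝ] ℝ) :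
    sharp B (c • α) = c • sharp B α := by
  simp only [sharp, map_smul, LinearMap.smul_comp]

end Linear

section Derivatives

variable [IsManifold I 1 N]

/-- The coordinates of tangent vectors near `x` in the preferred chart at `x`. -/
def toCoord (x y : N) : TangentSpace I y →L[ℝ] E :=
  (trivializationAt E (TangentSpace I) x).continuousLinearMapAt ℝ y

/-- The tangent vectors near `x` with given coordinates in the preferred chart at `x`. -/
def ofCoord (x y : N) : E →L[ℝ] TangentSpace I y :=
  (trivializationAt E (TangentSpace I) x).symmL ℝ y

/-- The vector field near `x` with value `e` at `x` and constant components in the preferred chart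
at `x`. -/
def constField (x : N) (e : TangentSpace I x) : VField I N :=
  fun y => ofCoord I x y (toCoord I x x e)

theorem mdifferentiableAt_constField (x : N) (e : TangentSpace I x) :
    MDifferentiableAt I (I.prod 𝓘(ℝ, E))
      (fun y => (TotalSpace.mk' E y (constField I x e y) : TangentBundle I N)) x := by
  have hx := FiberBundle.mem_baseSet_trivializationAt E (TangentSpace I) x
  refine (FiberBundle.mdifferentiableAt_extend I E e).congr_of_eventuallyEq ?_
  filter_upwards [(trivializationAt E (TangentSpace I) x).open_baseSet.mem_nhds hx] with y hy
  simp only [constField, ofCoord, toCoord, FiberBundle.extend]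
  rw [Trivialization.continuousLinearMapAt_apply, Trivialization.linearMapAt_apply, if_pos hx,
    Trivialization.symmL_apply _ hy]

theorem constField_add (x : N) (e e' : TangentSpace I x) :
    constField I x (e + e') = constField I x e + constField I x e' := by
  funext y
  simp only [constField, Pi.add_apply, map_add]

theorem constField_smul (x : N) (c : ℝ) (e : TangentSpace I x) :
    constField I x (c • e) = c • constField I x e := by
  funext y
  simp only [constField, Pi.smul_apply, map_smul]

variable [FiniteDimensional ℝ E]

/-- The coordinate vector `∂_i` at `y`, in the preferred chart at `x`. -/
def coordVec (x y : N) (i : Fin (Module.finrank ℝ E)) : TangentSpace I y :=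
  ofCoord I x y (Module.finBasis ℝ E i)

/-- The coordinate 1-form `dx^i` at `y`, in the preferred chart at `x`. -/
def coordForm (x y : N) (i : Fin (Module.finrank ℝ E)) : Cotangent I y :=
  (LinearMap.toContinuousLinearMap ((Module.finBasis ℝ E).coord i)).comp (toCoord I x y)

/-- The derivative at `x`, in the direction `v`, of the components of the tensor field `Q` in the
preferred chart at `x`, i.e. `v(Q^{ij}) ∂_i ⊗ ∂_j` with `Q^{ij} = Q(dx^i, dx^j)`. -/
def coordDeriv (Q : Tensor2 I N) (x : N) (v : TangentSpace I x) :
    LinearMap.BilinForm ℝ (Cotangent I x) :=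
  LinearMap.mk₂ ℝ
    (fun α β => ∑ i, ∑ j,
      mvfderiv I (fun y => Q y (coordForm I x y i) (coordForm I x y j)) x v
        * (α (coordVec I x x i) * β (coordVec I x x j)))
    (by intro a b c; simp only [_root_.add_apply, add_mul, mul_add,
          Finset.sum_add_distrib])
    (by intro r a b; simp only [_root_.smul_apply, smul_eq_mul, Finset.mul_sum]
        refine Finset.sum_congr rfl fun i _ => Finset.sum_congr rfl fun j _ => by ring)
    (by intro a b c; simp only [_root_.add_apply, mul_add,
          Finset.sum_add_distrib])
    (by intro r a b; simp only [_root_.smul_apply, smul_eq_mul, Finset.mul_sum]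
        refine Finset.sum_congr rfl fun i _ => Finset.sum_congr rfl fun j _ => by ring)

/-- The Jacobian at `x` of the components of the vector field `X` in the preferred chart at `x`. -/
def jacobian (X : VField I N) (x : N) : TangentSpace I x →L[ℝ] TangentSpace I x :=
  (ofCoord I x x).comp (mvfderiv I (fun y => toCoord I x y (X y)) x)

/-- The Lie derivative `L_X Q` of a 2-contravariant tensor field, which in coordinates is
`(L_X Q)^{ij} = X^k ∂_k Q^{ij} - Q^{kj} ∂_k X^i - Q^{ik} ∂_k X^j`. -/
def lieDeriv (X : VField I N) (Q : Tensor2 I N) : Tensor2 I N :=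
  fun x => coordDeriv I Q x (X x) - actEnd (jacobian I X x) (Q x)

/-! ### Linear connections -/

variable (nabla : CovariantDerivative I E (TangentSpace I : N → Type _))

/-- The connection coefficients at `x` in the preferred chart at `x`: `christoffel v e` is
`∇_v ē`, where `ē` is the vector field with constant components in this chart and value `e`
at `x`. That is, `∂_i, ∂_j ↦ Γ^k_{ij} ∂_k = ∇_{∂_i} ∂_j`. -/
def christoffel (x : N) (v : TangentSpace I x) : TangentSpace I x →L[ℝ] TangentSpace I x :=
  LinearMap.toContinuousLinearMap
    { toFun := fun e => nabla (constField I x e) x v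
      map_add' := by
        intro e e'
        rw [constField_add, nabla.isCovariantDerivativeOnUniv.add
          (mdifferentiableAt_constField I x e) (mdifferentiableAt_constField I x e')]
        rfl
      map_smul' := by
        intro c e
        rw [constField_smul, nabla.isCovariantDerivativeOnUniv.smul_const c
          (mdifferentiableAt_constField I x e)]
        rfl }

theorem christoffel_apply (x : N) (v e : TangentSpace I x) :
    christoffel I nabla x v e = nabla (constField I x e) x v := rfl

theorem christoffel_add (x : N) (v v' : TangentSpace I x) :
    christoffel I nabla x (v + v') = christoffel I nabla x v + christoffel I nabla x v' :=
  ContinuousLinearMap.ext fun e => map_add (nabla (constField I x e) x) v v'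

theorem christoffel_smul (x : N) (c : ℝ) (v : TangentSpace I x) :
    christoffel I nabla x (c • v) = c • christoffel I nabla x v :=
  ContinuousLinearMap.ext fun e => map_smul (nabla (constField I x e) x) c v

/-- The covariant derivative `∇_v β` of a 1-form at `x`; in coordinates
`v^i (∂_i β_j - Γ^k_{ij} β_k) dx^j`. -/
def nablaForm (β : OneForm I N) (x : N) (v : TangentSpace I x) : Cotangent I x :=
  (mvfderiv I (fun y => (β y).comp (ofCoord I x y)) x v).comp (toCoord I x x)
    - (β x).comp (christoffel I nabla x v)

/-- The covariant derivative `∇_v w` of a 2-contravariant tensor field at `x`; in coordinates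
`v^k (∂_k w^{ij} + Γ^i_{kl} w^{lj} + Γ^j_{kl} w^{il}) ∂_i ⊗ ∂_j`. -/
def nablaTensor (w : Tensor2 I N) (x : N) (v : TangentSpace I x) :
    LinearMap.BilinForm ℝ (Cotangent I x) :=
  coordDeriv I w x v + actEnd (christoffel I nabla x v) (w x)

theorem nablaTensor_add (w : Tensor2 I N) (x : N) (v v' : TangentSpace I x) :
    nablaTensor I nabla w x (v + v') = nablaTensor I nabla w x v + nablaTensor I nabla w x v' := by
  ext α β
  simp only [nablaTensor, coordDeriv, LinearMap.add_apply, LinearMap.mk₂_apply, actEnd_apply,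
    christoffel_add, ContinuousLinearMap.comp_add, map_add, add_mul, Finset.sum_add_distrib]
  ring

theorem nablaTensor_smul (w : Tensor2 I N) (x : N) (c : ℝ) (v : TangentSpace I x) :
    nablaTensor I nabla w x (c • v) = c • nablaTensor I nabla w x v := by
  ext α β
  simp only [nablaTensor, coordDeriv, LinearMap.add_apply, LinearMap.smul_apply,
    LinearMap.mk₂_apply, actEnd_apply, christoffel_smul, ContinuousLinearMap.comp_smul, map_smul,
    smul_eq_mul, mul_assoc, ← Finset.mul_sum]
  ring

end Derivatives

end General

section Base

/-! ### Objects on a manifold `M` with a 2-contravariant tensor field and a linear connection -/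

variable {E : Type*} [NormedAddCommGroup E] [NormedSpace ℝ E] [FiniteDimensional ℝ E]
  {H : Type*} [TopologicalSpace H] (I : ModelWithCorners ℝ E H)
  {M : Type*} [TopologicalSpace M] [ChartedSpace H M] [IsManifold I ∞ M]

/-- A smooth vector field on `M`. -/
def SmoothVField (X : VField I M) : Prop :=
  ContMDiff I (I.prod 𝓘(ℝ, E)) ∞ (fun x => (TotalSpace.mk' E x (X x) : TangentBundle I M))

variable (M) in
/-- The cotangent bundle `T*M`, a manifold with the natural charts `(x^i, p_i)`. -/
abbrev CotangentBundle : Type _ :=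
  TotalSpace (E →L[ℝ] ℝ) (fun x : M => TangentSpace I x →L[ℝ] ℝ)

/-- A smooth 1-form on `M`. -/
def SmoothOneForm (α : OneForm I M) : Prop :=
  ContMDiff I (I.prod 𝓘(ℝ, E →L[ℝ] ℝ)) ∞
    (fun x => (TotalSpace.mk' (E →L[ℝ] ℝ) x (α x) : CotangentBundle I M))

/-- `D` is a contravariant derivative on `TM` with respect to `w`: an `ℝ`-bilinear operator
`(α, X) ↦ D_α X`, from smooth 1-forms and smooth vector fields to smooth vector fields, with
`D_{fα} X = f D_α X` and `D_α (fX) = f D_α X + (α^♯ f) X`. -/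
structure IsContravariantDerivative (w : Tensor2 I M)
    (D : OneForm I M → VField I M → VField I M) : Prop where
  smooth : ∀ α X, SmoothOneForm I α → SmoothVField I X → SmoothVField I (D α X)
  add_form : ∀ α α' X, SmoothOneForm I α → SmoothOneForm I α' → SmoothVField I X →
    D (α + α') X = D α X + D α' X
  add_field : ∀ α X X', SmoothOneForm I α → SmoothVField I X → SmoothVField I X' →
    D α (X + X') = D α X + D α X'
  smul_form : ∀ (f : M → ℝ) (α) (X), SmoothFun I f → SmoothOneForm I α → SmoothVField I X →
    D (fun x => f x • α x) X = fun x => f x • D α X x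
  leibniz : ∀ (f : M → ℝ) (α) (X), SmoothFun I f → SmoothOneForm I α → SmoothVField I X →
    D α (fun x => f x • X x)
      = fun x => f x • D α X x + (mvfderiv I f x (sharp (w x) (α x))) • X x

/-- An operator `D'` on 1-forms and an operator `D` on vector fields are dual with respect to `w`:
`α^♯⟨β, X⟩ = ⟨D'_α β, X⟩ + ⟨β, D_α X⟩`. -/
def AreDual (w : Tensor2 I M) (D' : OneForm I M → OneForm I M → OneForm I M)
    (D : OneForm I M → VField I M → VField I M) : Prop :=
  ∀ α β X, SmoothOneForm I α → SmoothOneForm I β → SmoothVField I X → ∀ x : M,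
    mvfderiv I (fun y => β y (X y)) x (sharp (w x) (α x)) = D' α β x (X x) + β x (D α X x)

variable (w : Tensor2 I M) (nabla : CovariantDerivative I E (TangentSpace I : M → Type _))

/-- The contravariant derivative `D_α X = ∇_{α^♯} X` induced by `∇`. -/
def contraD (α : OneForm I M) (X : VField I M) : VField I M :=
  fun x => nabla X x (sharp (w x) (α x))

/-- The contravariant derivative `D_α β = ∇_{α^♯} β` of 1-forms induced by `∇`. -/
def contraDForm (α β : OneForm I M) : OneForm I M :=
  fun x => nablaForm I nabla β x (sharp (w x) (α x))

/-- The 1-form `(∇_· w)(α, β) : v ↦ (∇_v w)(α, β)`. -/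
def nablaDot (α β : OneForm I M) : OneForm I M := fun x =>
  LinearMap.toContinuousLinearMap
    { toFun := fun v => nablaTensor I nabla w x v (α x) (β x)
      map_add' := by
        intro v v'
        rw [nablaTensor_add]
        rfl
      map_smul' := by
        intro c v
        rw [nablaTensor_smul]
        rfl }

/-- The operator `D̄_α β = D_α β + ½ (∇_· w)(α, β)` on 1-forms. -/
def barDForm (α β : OneForm I M) : OneForm I M :=
  fun x => contraDForm I w nabla α β x + (1 / 2 : ℝ) • nablaDot I w nabla α β x

/-- The operator on vector fields dual to `D̄`: `⟨β, D̄_α X⟩ = ⟨β, D_α X⟩ - ½ (∇_X w)(α, β)`. -/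
def barD (α : OneForm I M) (X : VField I M) : VField I M :=
  fun x => contraD I w nabla α X x - (1 / 2 : ℝ) • sharp (nablaTensor I nabla w x (X x)) (α x)

/-- The symmetrized derivative `(ˢD X)(α, β) = ½ ((D_α X) β + (D_β X) α)` of a vector field. -/
def symD (X : VField I M) : Tensor2 I M := fun x =>
  LinearMap.mk₂ ℝ
    (fun α β : Cotangent I x =>
      (1 / 2 : ℝ) * (β (nabla X x (sharp (w x) α)) + α (nabla X x (sharp (w x) β))))
    (by intro a b c; simp only [sharp_add, map_add, _root_.add_apply]; ring)
    (by intro r a b; simp only [sharp_smul, map_smul, _root_.smul_apply,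
          smul_eq_mul]; ring)
    (by intro a b c; simp only [sharp_add, map_add, _root_.add_apply]; ring)
    (by intro r a b; simp only [sharp_smul, map_smul, _root_.smul_apply,
          smul_eq_mul]; ring)

/-- The Schouten-Nijenhuis bracket `⟨X, Q⟩` of a vector field and a symmetric 2-contravariant
tensor field. The bracket of symmetric contravariant tensor fields is the extension of the Lie
bracket `⟨X, Y⟩ = [X, Y]` and of `⟨X, f⟩ = X f` by derivations of the symmetric product, so that
`⟨X, Q⟩ = L_X Q`. -/
def schoutenFieldTensor (X : VField I M) (Q : Tensor2 I M) : Tensor2 I M := lieDeriv I X Q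

/-- The Schouten-Nijenhuis bracket `⟨Q, X⟩ = -⟨X, Q⟩`. -/
def schoutenTensorField (Q : Tensor2 I M) (X : VField I M) : Tensor2 I M :=
  -schoutenFieldTensor I X Q

/-! ### Objects on the cotangent bundle -/

/-- The lift `f ∘ π` to `T*M` of a function on `M`. -/
def lift (f : M → ℝ) : CotangentBundle I M → ℝ := fun p => f p.1

/-- The momentum `m(X) = p_i X^i` of a vector field. -/
def momentum (X : VField I M) : CotangentBundle I M → ℝ := fun p => p.2 (X p.1)

/-- The fiberwise quadratic function `s(Q) = Q^{ij} p_i p_j`. -/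
def quad (Q : Tensor2 I M) : CotangentBundle I M → ℝ := fun p => Q p.1 p.2 p.2

/-- The coordinate vectors `e^i ∂/∂x^i` at `p`, in the natural chart `(x^i, p_i)` at `p`. -/
def baseVec (p : CotangentBundle I M) : E →L[ℝ] TangentSpace (I.prod 𝓘(ℝ, E →L[ℝ] ℝ)) p :=
  ContinuousLinearMap.inl ℝ E (E →L[ℝ] ℝ)

/-- The vertical vectors `η_i ∂/∂p_i` at `p`, in the natural chart `(x^i, p_i)` at `p`. -/
def fiberVec (p : CotangentBundle I M) :
    (E →L[ℝ] ℝ) →L[ℝ] TangentSpace (I.prod 𝓘(ℝ, E →L[ℝ] ℝ)) p :=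
  ContinuousLinearMap.inr ℝ E (E →L[ℝ] ℝ)

/-- The horizontal lift to `p ∈ T*M` of a tangent vector `v` of `M`:
`v^i ∂/∂x^i + v^i Γ^k_{ij} p_k ∂/∂p_j`. -/
def horizontalLift (p : CotangentBundle I M) (v : TangentSpace I p.1) :
    TangentSpace (I.prod 𝓘(ℝ, E →L[ℝ] ℝ)) p :=
  baseVec I p (toCoord I p.1 p.1 v)
    + fiberVec I p (((p.2 : Cotangent I p.1).comp (christoffel I nabla p.1 v)).comp
        (ofCoord I p.1 p.1))

/-- The vector field `K(α) = (α^♯)^H` on `T*M`. -/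
def fieldK : VField (I.prod 𝓘(ℝ, E →L[ℝ] ℝ)) (CotangentBundle I M) :=
  fun p => horizontalLift I nabla p (sharp (w p.1) p.2)

/-- The base part `e ↦ Φ(e^i ∂/∂x^i)` of a covector `Φ` of `T*M` at `p`. -/
def basePart (p : CotangentBundle I M) :
    Cotangent (I.prod 𝓘(ℝ, E →L[ℝ] ℝ)) p →ₗ[ℝ] (E →L[ℝ] ℝ) := precompose (baseVec I p)

/-- The fiber part `η ↦ Φ(η_i ∂/∂p_i)` of a covector `Φ` of `T*M` at `p`. -/
def fiberPart (p : CotangentBundle I M) :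
    Cotangent (I.prod 𝓘(ℝ, E →L[ℝ] ℝ)) p →ₗ[ℝ] ((E →L[ℝ] ℝ) →ₗ[ℝ] ℝ) where
  toFun Φ := (Φ.comp (fiberVec I p)).toLinearMap
  map_add' _ _ := rfl
  map_smul' _ _ := rfl

/-- The canonical Poisson bivector `W₀ = ∂/∂p_i ∧ ∂/∂x^i` of `T*M`:
`W₀(Φ, Ψ) = Φ(∂/∂p_i) Ψ(∂/∂x^i) - Ψ(∂/∂p_i) Φ(∂/∂x^i)`, the bivector of the canonical symplectic
form `dp_i ∧ dx^i` (the expression is the same in all natural charts). -/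
def canonicalPoisson : Tensor2 (I.prod 𝓘(ℝ, E →L[ℝ] ℝ)) (CotangentBundle I M) := fun p =>
  (fiberPart I p).compl₂ (basePart I p)
    - ((fiberPart I p).compl₂ (basePart I p)).flip

theorem canonicalPoisson_apply (p : CotangentBundle I M)
    (Φ Ψ : Cotangent (I.prod 𝓘(ℝ, E →L[ℝ] ℝ)) p) :
    canonicalPoisson I p Φ Ψ
      = Φ (fiberVec I p (Ψ.comp (baseVec I p))) - Ψ (fiberVec I p (Φ.comp (baseVec I p))) := rfl

/-- The graded `∇`-lift `W₂ = ½ L_K W₀` of `w`. -/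
def gradedLift : Tensor2 (I.prod 𝓘(ℝ, E →L[ℝ] ℝ)) (CotangentBundle I M) :=
  (1 / 2 : ℝ) • lieDeriv (I.prod 𝓘(ℝ, E →L[ℝ] ℝ)) (fieldK I w nabla) (canonicalPoisson I)

/-- The first bracket relation for a bivector field `W` on `T*M`: `{f, g}_W = {f, g}_w`. -/
def BaseBracket (W : Tensor2 (I.prod 𝓘(ℝ, E →L[ℝ] ℝ)) (CotangentBundle I M)) : Prop :=
  ∀ f g : M → ℝ, SmoothFun I f → SmoothFun I g →
    bracket (I.prod 𝓘(ℝ, E →L[ℝ] ℝ)) W (lift I f) (lift I g) = lift I (bracket I w f g)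

/-- The second bracket relation: `{m(X), f}_W = -m(D̄_{df} X)`. -/
def MixedBracket (W : Tensor2 (I.prod 𝓘(ℝ, E →L[ℝ] ℝ)) (CotangentBundle I M)) : Prop :=
  ∀ (f : M → ℝ) (X : VField I M), SmoothFun I f → SmoothVField I X →
    bracket (I.prod 𝓘(ℝ, E →L[ℝ] ℝ)) W (momentum I X) (lift I f)
      = -momentum I (barD I w nabla (mvfderiv I f) X)

/-- The third bracket relation:
`{m(X), m(Y)}_W = ½ s(ˢD⟨X, Y⟩ - ⟨ˢD X, Y⟩ - ⟨X, ˢD Y⟩)`. -/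
def MomentumBracket (W : Tensor2 (I.prod 𝓘(ℝ, E →L[ℝ] ℝ)) (CotangentBundle I M)) : Prop :=
  ∀ X Y : VField I M, SmoothVField I X → SmoothVField I Y →
    bracket (I.prod 𝓘(ℝ, E →L[ℝ] ℝ)) W (momentum I X) (momentum I Y)
      = (1 / 2 : ℝ) • quad I (symD I w nabla (mlieBracket I X Y)
          - schoutenTensorField I (symD I w nabla X) Y
          - schoutenFieldTensor I X (symD I w nabla Y))

end Base

end GradedLift

end

noncomputable section

namespace GradedLift

open scoped Topology

section Calculus

variable {E : Type*} [NormedAddCommGroup E] [NormedSpace ℝ E]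
  {H : Type*} [TopologicalSpace H] {I : ModelWithCorners ℝ E H}
  {N : Type*} [TopologicalSpace N] [ChartedSpace H N]
  {F F₁ F₂ F₃ : Type*} [NormedAddCommGroup F] [NormedSpace ℝ F]
  [NormedAddCommGroup F₁] [NormedSpace ℝ F₁] [NormedAddCommGroup F₂] [NormedSpace ℝ F₂]
  [NormedAddCommGroup F₃] [NormedSpace ℝ F₃]

/-! ### Derivatives of vector-valued functions on a manifold -/

variable (I) in
/-- `L` is the derivative at `x` of the vector-valued function `f` on a manifold. -/
def HasVDeriv (f : N → F) (x : N) (L : TangentSpace I x →L[ℝ] F) : Prop :=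
  HasMFDerivAt I 𝓘(ℝ, F) f x L

theorem mvfderiv_congr_of_eventuallyEq {f g : N → F} {x : N} (h : f =ᶠ[𝓝 x] g) :
    mvfderiv I f x = mvfderiv I g x := by
  ext v
  exact congrArg (fun L : TangentSpace I x →L[ℝ] F => L v) h.mfderiv_eq

theorem hasVDeriv_mvfderiv {f : N → F} {x : N} (h : MDifferentiableAt I 𝓘(ℝ, F) f x) :
    HasVDeriv I f x (mvfderiv I f x) := h.hasMFDerivAt

namespace HasVDeriv

theorem mvfderiv_eq {f : N → F} {x : N} {L : TangentSpace I x →L[ℝ] F}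
    (h : HasVDeriv I f x L) : mvfderiv I f x = L := by
  ext v
  exact congrArg (fun L : TangentSpace I x →L[ℝ] F => L v) (HasMFDerivAt.mfderiv h)

theorem congr_of_eventuallyEq {f g : N → F} {x : N} {L : TangentSpace I x →L[ℝ] F}
    (h : HasVDeriv I f x L) (hfg : g =ᶠ[𝓝 x] f) : HasVDeriv I g x L :=
  HasMFDerivAt.congr_of_eventuallyEq h hfg

theorem comp_fderiv {f : N → F₁} {x : N} {L : TangentSpace I x →L[ℝ] F₁}
    (h : HasVDeriv I f x L) {g : F₁ → F₂} {L' : F₁ →L[ℝ] F₂}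
    (hg : HasFDerivAt g L' (f x)) : HasVDeriv I (fun y => g (f y)) x (L'.comp L) :=
  HasMFDerivAt.comp x hg.hasMFDerivAt h

theorem prodMk {f : N → F₁} {g : N → F₂} {x : N} {L : TangentSpace I x →L[ℝ] F₁}
    {L' : TangentSpace I x →L[ℝ] F₂} (hf : HasVDeriv I f x L) (hg : HasVDeriv I g x L') :
    HasVDeriv I (fun y => (f y, g y)) x (L.prod L') :=
  ⟨hf.1.prodMk hg.1, hf.2.prodMk hg.2⟩

theorem bilin (B : F₁ →L[ℝ] F₂ →L[ℝ] F₃) {f : N → F₁} {g : N → F₂} {x : N}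
    {L : TangentSpace I x →L[ℝ] F₁} {L' : TangentSpace I x →L[ℝ] F₂}
    (hf : HasVDeriv I f x L) (hg : HasVDeriv I g x L') :
    HasVDeriv I (fun y => B (f y) (g y)) x ((B (f x)).comp L' + (B.flip (g x)).comp L) :=
  (hf.prodMk hg).comp_fderiv (g := fun p : F₁ × F₂ => B p.1 p.2)
    ((B.isBoundedBilinearMap).hasFDerivAt (f x, g x))

theorem const (c : F) (x : N) : HasVDeriv I (fun _ => c) x 0 :=
  hasMFDerivAt_const c x

theorem add {f g : N → F} {x : N} {L L' : TangentSpace I x →L[ℝ] F}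
    (hf : HasVDeriv I f x L) (hg : HasVDeriv I g x L') :
    HasVDeriv I (fun y => f y + g y) x (L + L') :=
  HasMFDerivAt.add hf hg

theorem sum {ι : Type*} (s : Finset ι) {f : ι → N → F} {x : N}
    {L : ι → TangentSpace I x →L[ℝ] F} (hf : ∀ i ∈ s, HasVDeriv I (f i) x (L i)) :
    HasVDeriv I (fun y => ∑ i ∈ s, f i y) x (∑ i ∈ s, L i) := by
  classical
  induction s using Finset.induction_on with
  | empty => exact const 0 x
  | insert a s ha ih =>
    simp only [Finset.sum_insert ha]
    exact (hf a (Finset.mem_insert_self a s)).add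
      (ih fun i hi => hf i (Finset.mem_insert_of_mem hi))

end HasVDeriv

theorem mvfderiv_comp_fderiv {f : N → F₁} {x : N} (h : MDifferentiableAt I 𝓘(ℝ, F₁) f x)
    {g : F₁ → F₂} {L' : F₁ →L[ℝ] F₂} (hg : HasFDerivAt g L' (f x)) (v : TangentSpace I x) :
    mvfderiv I (fun y => g (f y)) x v = L' (mvfderiv I f x v) := by
  rw [((hasVDeriv_mvfderiv h).comp_fderiv hg).mvfderiv_eq]
  rfl

theorem mvfderiv_bilin (B : F₁ →L[ℝ] F₂ →L[ℝ] F₃) {f : N → F₁} {g : N → F₂} {x : N}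
    (hf : MDifferentiableAt I 𝓘(ℝ, F₁) f x) (hg : MDifferentiableAt I 𝓘(ℝ, F₂) g x)
    (v : TangentSpace I x) :
    mvfderiv I (fun y => B (f y) (g y)) x v
      = B (mvfderiv I f x v) (g x) + B (f x) (mvfderiv I g x v) := by
  rw [((hasVDeriv_mvfderiv hf).bilin B (hasVDeriv_mvfderiv hg)).mvfderiv_eq]
  exact add_comm _ _

theorem mvfderiv_real_mul {f g : N → ℝ} {x : N}
    (hf : MDifferentiableAt I 𝓘(ℝ, ℝ) f x) (hg : MDifferentiableAt I 𝓘(ℝ, ℝ) g x)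
    (v : TangentSpace I x) :
    mvfderiv I (fun y => f y * g y) x v
      = mvfderiv I f x v * g x + f x * mvfderiv I g x v :=
  mvfderiv_bilin (ContinuousLinearMap.mul ℝ ℝ) hf hg v

theorem contMDiffAt_bilin (B : F₁ →L[ℝ] F₂ →L[ℝ] F₃) {f : N → F₁} {g : N → F₂} {x : N}
    (hf : ContMDiffAt I 𝓘(ℝ, F₁) ∞ f x) (hg : ContMDiffAt I 𝓘(ℝ, F₂) ∞ g x) :
    ContMDiffAt I 𝓘(ℝ, F₃) ∞ (fun y => B (f y) (g y)) x := by
  have hB : ContDiff ℝ ∞ (fun p : F₁ × F₂ => B p.1 p.2) := B.isBoundedBilinearMap.contDiff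
  exact hB.contDiffAt.comp_contMDiffAt (hf.prodMk_space hg)

theorem mvfderiv_sum {ι : Type*} (s : Finset ι) {f : ι → N → F} {x : N}
    (hf : ∀ i ∈ s, MDifferentiableAt I 𝓘(ℝ, F) (f i) x) (v : TangentSpace I x) :
    mvfderiv I (fun y => ∑ i ∈ s, f i y) x v = ∑ i ∈ s, mvfderiv I (f i) x v := by
  rw [(HasVDeriv.sum s fun i hi => hasVDeriv_mvfderiv (hf i hi)).mvfderiv_eq]
  exact sum_apply _ _ _

theorem mdifferentiableAt_of_contMDiffAt {f : N → F} {x : N}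
    (hf : ContMDiffAt I 𝓘(ℝ, F) ∞ f x) : MDifferentiableAt I 𝓘(ℝ, F) f x :=
  hf.mdifferentiableAt (by simp)

end Calculus

section Charts

variable {E : Type*} [NormedAddCommGroup E] [NormedSpace ℝ E]
  {H : Type*} [TopologicalSpace H] {I : ModelWithCorners ℝ E H}
  {N : Type*} [TopologicalSpace N] [ChartedSpace H N]
  {F : Type*} [NormedAddCommGroup F] [NormedSpace ℝ F]

section

variable [IsManifold I 1 N]

theorem toCoord_self (x : N) (v : TangentSpace I x) : toCoord I x x v = v := by
  have h := congrArg (fun L : TangentSpace I x →L[ℝ] E => L v)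
    (TangentBundle.continuousLinearMapAt_trivializationAt (I := I) (mem_chart_source H x))
  refine h.trans ?_
  exact congrArg (fun L : E →L[ℝ] E => L v) (mfderiv_extChartAt_self (I := I) (x := x))

theorem toCoord_ofCoord {x y : N} (hy : y ∈ (chartAt H x).source) (e : E) :
    toCoord I x y (ofCoord I x y e) = e :=
  (trivializationAt E (TangentSpace I) x).continuousLinearMapAt_symmL (R := ℝ) hy e

theorem ofCoord_toCoord {x y : N} (hy : y ∈ (chartAt H x).source) (v : TangentSpace I y) :
    ofCoord I x y (toCoord I x y v) = v :=
  (trivializationAt E (TangentSpace I) x).symmL_continuousLinearMapAt (R := ℝ) hy v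

theorem ofCoord_self (x : N) (e : E) : ofCoord I x x e = e := by
  rw [← toCoord_self x (ofCoord I x x e), toCoord_ofCoord (mem_chart_source H x)]

theorem eventually_mem_chart_source (x : N) : ∀ᶠ y in 𝓝 x, y ∈ (chartAt H x).source :=
  (chartAt H x).open_source.mem_nhds (mem_chart_source H x)

theorem toCoord_eq_mfderiv {x y : N} (hy : y ∈ (chartAt H x).source) (v : TangentSpace I y) :
    toCoord I x y v = mvfderiv I (extChartAt I x) y v :=
  congrArg (fun L : TangentSpace I y →L[ℝ] E => L v)
    (TangentBundle.continuousLinearMapAt_trivializationAt (I := I) hy)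

theorem mvfderiv_comp_extChartAt {x y : N} (hy : y ∈ (chartAt H x).source) (ℓ : E →L[ℝ] F)
    (v : TangentSpace I y) :
    mvfderiv I (fun z => ℓ (extChartAt I x z)) y v = ℓ (toCoord I x y v) := by
  rw [toCoord_eq_mfderiv hy]
  exact mvfderiv_comp_fderiv (mdifferentiableAt_extChartAt hy) ℓ.hasFDerivAt v

end

variable [I.Boundaryless]

theorem hasFDerivAt_of_hasVDeriv {f : N → F} {x : N} {L : E →L[ℝ] F}
    (h : HasVDeriv I f x L) :
    HasFDerivAt (fun u => f ((extChartAt I x).symm u)) L (extChartAt I x x) := by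
  have h2 : HasFDerivWithinAt (fun u => f ((extChartAt I x).symm u)) L (Set.range I)
    (extChartAt I x x) := h.2
  rwa [I.range_eq_univ, hasFDerivWithinAt_univ] at h2

theorem mvfderiv_eq_fderiv {f : N → F} {x : N} (h : MDifferentiableAt I 𝓘(ℝ, F) f x) (v : E) :
    mvfderiv I f x v = fderiv ℝ (fun u => f ((extChartAt I x).symm u)) (extChartAt I x x) v := by
  rw [(hasFDerivAt_of_hasVDeriv (hasVDeriv_mvfderiv h)).fderiv]
  rfl

theorem mvfderiv_extChartAt_symm [IsManifold I 1 N] {f : N → F} {x : N} {u : E}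
    (hu : u ∈ (extChartAt I x).target)
    (h : MDifferentiableAt I 𝓘(ℝ, F) f ((extChartAt I x).symm u)) (e : E) :
    mvfderiv I f ((extChartAt I x).symm u) (ofCoord I x ((extChartAt I x).symm u) e)
      = fderiv ℝ (fun u => f ((extChartAt I x).symm u)) u e := by
  have hy : (extChartAt I x).symm u ∈ (chartAt H x).source := by
    rw [← extChartAt_source I]
    exact (extChartAt I x).map_target hu
  have hs := mdifferentiableWithinAt_extChartAt_symm hu
  rw [I.range_eq_univ, mdifferentiableWithinAt_univ] at hs
  have e1 : ofCoord I x ((extChartAt I x).symm u) e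
      = mfderiv 𝓘(ℝ, E) I (extChartAt I x).symm u e := by
    refine (congrArg (fun L : E →L[ℝ] TangentSpace I ((extChartAt I x).symm u) => L e)
      (TangentBundle.symmL_trivializationAt (I := I) hy)).trans ?_
    rw [I.range_eq_univ, mfderivWithin_univ, (extChartAt I x).right_inv hu]
    rfl
  let A : E →L[ℝ] TangentSpace I ((extChartAt I x).symm u) :=
    mfderiv 𝓘(ℝ, E) I (extChartAt I x).symm u
  have h1 : HasMFDerivAt 𝓘(ℝ, E) 𝓘(ℝ, F) (fun u => f ((extChartAt I x).symm u)) u _ :=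
    HasMFDerivAt.comp u h.hasMFDerivAt hs.hasMFDerivAt
  have h3 : HasFDerivAt (fun u => f ((extChartAt I x).symm u))
    ((mvfderiv I f ((extChartAt I x).symm u)).comp A) u := hasMFDerivAt_iff_hasFDerivAt.1 h1
  have h2 := h3.fderiv
  rw [e1]
  exact (congrArg (fun L : E →L[ℝ] F => L e) h2).symm

theorem mvfderiv_ofCoord [IsManifold I 1 N] {f : N → F} {x y : N} (hy : y ∈ (chartAt H x).source)
    (h : MDifferentiableAt I 𝓘(ℝ, F) f y) (e : E) :
    mvfderiv I f y (ofCoord I x y e)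
      = fderiv ℝ (fun u => f ((extChartAt I x).symm u)) (extChartAt I x y) e := by
  rw [← extChartAt_source I] at hy
  have h1 := mvfderiv_extChartAt_symm (x := x) (f := f) ((extChartAt I x).map_source hy)
  rw [(extChartAt I x).left_inv hy] at h1
  exact h1 h e

theorem contDiffAt_extChartAt_symm {f : N → F} {x : N} (h : ContMDiffAt I 𝓘(ℝ, F) ∞ f x) :
    ContDiffAt ℝ ∞ (fun u => f ((extChartAt I x).symm u)) (extChartAt I x x) := by
  have h2 := (contMDiffAt_iff.1 h).2
  rw [I.range_eq_univ, contDiffWithinAt_univ] at h2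
  exact h2

variable [IsManifold I ∞ N]

/-- The components of the differential of a smooth function, near `x` and in the preferred chart
at `x`, are its partial derivatives. -/
theorem mvfderiv_comp_ofCoord_eventuallyEq {f : N → F} {x : N}
    (h : ContMDiffAt I 𝓘(ℝ, F) ∞ f x) :
    (fun y => (mvfderiv I f y).comp (ofCoord I x y)) =ᶠ[𝓝 x]
      fun y => fderiv ℝ (fun u => f ((extChartAt I x).symm u)) (extChartAt I x y) := by
  have h1 : ∀ᶠ y in 𝓝 x, ContMDiffAt I 𝓘(ℝ, F) 1 f y :=
    (contMDiffAt_iff_contMDiffAt_nhds (by simp)).1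
      (ContMDiffAt.of_le (n := ∞) h (by exact_mod_cast le_top))
  filter_upwards [h1, eventually_mem_chart_source (H := H) x] with y hy hy'
  ext e
  exact mvfderiv_ofCoord hy' (hy.mdifferentiableAt one_ne_zero) e

theorem contMDiffAt_mvfderiv_comp_ofCoord {f : N → F} {x : N}
    (h : ContMDiffAt I 𝓘(ℝ, F) ∞ f x) :
    ContMDiffAt I 𝓘(ℝ, E →L[ℝ] F) ∞ (fun y => (mvfderiv I f y).comp (ofCoord I x y)) x := by
  refine ContMDiffAt.congr_of_eventuallyEq ?_ (mvfderiv_comp_ofCoord_eventuallyEq h)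
  have h1 : ContDiffAt ℝ ∞ (fderiv ℝ (fun u => f ((extChartAt I x).symm u)))
    (extChartAt I x x) := (contDiffAt_extChartAt_symm h).fderiv_right (by simp)
  exact h1.comp_contMDiffAt (contMDiffAt_extChartAt (n := ∞))

/-- Symmetry of the second derivative, in the preferred chart. -/
theorem mvfderiv_mvfderiv_symm {f : N → F} {x : N} (h : ContMDiffAt I 𝓘(ℝ, F) ∞ f x)
    (u v : TangentSpace I x) :
    mvfderiv I (fun y => (mvfderiv I f y).comp (ofCoord I x y)) x u (toCoord I x x v)
      = mvfderiv I (fun y => (mvfderiv I f y).comp (ofCoord I x y)) x v (toCoord I x x u) := by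
  have h0 := contDiffAt_extChartAt_symm h
  have h1 : ContDiffAt ℝ ∞ (fderiv ℝ (fun u => f ((extChartAt I x).symm u)))
    (extChartAt I x x) := h0.fderiv_right (by simp)
  have h2 : ∀ v : TangentSpace I x,
      mvfderiv I (fun y => (mvfderiv I f y).comp (ofCoord I x y)) x v
      = fderiv ℝ (fderiv ℝ (fun u => f ((extChartAt I x).symm u))) (extChartAt I x x)
        (toCoord I x x v) := by
    intro v
    rw [mvfderiv_congr_of_eventuallyEq (mvfderiv_comp_ofCoord_eventuallyEq h)]
    rw [mvfderiv_comp_fderiv (mdifferentiableAt_extChartAt (mem_chart_source H x))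
      (h1.differentiableAt (by simp)).hasFDerivAt, toCoord_eq_mfderiv (mem_chart_source H x)]
  rw [h2, h2]
  exact h0.isSymmSndFDerivAt (by simpa using ENat.LEInfty.out) _ _

end Charts

section TensorCalculus

variable {E : Type*} [NormedAddCommGroup E] [NormedSpace ℝ E]
  {H : Type*} [TopologicalSpace H] {I : ModelWithCorners ℝ E H}
  {N : Type*} [TopologicalSpace N] [ChartedSpace H N]

section

variable [IsManifold I 1 N]

/-! ### Smoothness of tensor fields at a point, in components -/

variable (I) in
/-- The components of the 1-form `α` in the preferred chart at `x` are smooth at `x`. -/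
def SmoothFormAt (α : OneForm I N) (x : N) : Prop :=
  ContMDiffAt I 𝓘(ℝ, E →L[ℝ] ℝ) ∞ (fun y => (α y).comp (ofCoord I x y)) x

variable (I) in
/-- The components of the vector field `X` in the preferred chart at `x` are smooth at `x`. -/
def SmoothFieldAt (X : VField I N) (x : N) : Prop :=
  ContMDiffAt I 𝓘(ℝ, E) ∞ (fun y => toCoord I x y (X y)) x

variable (I) in
/-- The derivative at `x`, in the direction `v`, of the components of the 1-form `α` in the
preferred chart at `x`. -/
def partialForm (α : OneForm I N) (x : N) (v : TangentSpace I x) : Cotangent I x :=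
  (mvfderiv I (fun y => (α y).comp (ofCoord I x y)) x v).comp (toCoord I x x)

theorem pairing_eventuallyEq (α : OneForm I N) (X : VField I N) (x : N) :
    (fun y => α y (X y)) =ᶠ[𝓝 x]
      fun y => ((α y).comp (ofCoord I x y)) (toCoord I x y (X y)) := by
  filter_upwards [eventually_mem_chart_source (H := H) x] with y hy
  exact congrArg (α y) (ofCoord_toCoord hy (X y)).symm

theorem contMDiffAt_pairing {α : OneForm I N} {X : VField I N} {x : N}
    (hα : SmoothFormAt I α x) (hX : SmoothFieldAt I X x) :
    ContMDiffAt I 𝓘(ℝ, ℝ) ∞ (fun y => α y (X y)) x :=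
  (contMDiffAt_bilin (ContinuousLinearMap.id ℝ (E →L[ℝ] ℝ)) hα hX).congr_of_eventuallyEq
    (pairing_eventuallyEq α X x)

theorem jacobian_apply (X : VField I N) (x : N) (v : TangentSpace I x) :
    jacobian I X x v = ofCoord I x x (mvfderiv I (fun y => toCoord I x y (X y)) x v) := rfl

theorem mvfderiv_pairing {α : OneForm I N} {X : VField I N} {x : N}
    (hα : SmoothFormAt I α x) (hX : SmoothFieldAt I X x) (v : TangentSpace I x) :
    mvfderiv I (fun y => α y (X y)) x v
      = partialForm I α x v (X x) + α x (jacobian I X x v) := by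
  rw [mvfderiv_congr_of_eventuallyEq (pairing_eventuallyEq α X x)]
  exact mvfderiv_bilin (ContinuousLinearMap.id ℝ (E →L[ℝ] ℝ))
    (mdifferentiableAt_of_contMDiffAt hα) (mdifferentiableAt_of_contMDiffAt hX) v

variable [FiniteDimensional ℝ E]

variable (I) in
/-- The components of the 2-contravariant tensor field `Q` in the preferred chart at `x` are smooth
at `x`. -/
def SmoothTensorAt (Q : Tensor2 I N) (x : N) : Prop :=
  ∀ i j, ContMDiffAt I 𝓘(ℝ, ℝ) ∞ (fun y => Q y (coordForm I x y i) (coordForm I x y j)) x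

theorem covector_eq_sum {x y : N} (hy : y ∈ (chartAt H x).source) (α : Cotangent I y) :
    α = ∑ i, α (coordVec I x y i) • coordForm I x y i := by
  ext v
  have h := (Module.finBasis ℝ E).sum_repr (toCoord I x y v)
  conv_lhs => rw [← ofCoord_toCoord hy v, ← h]
  rw [sum_apply, map_sum, map_sum]
  refine Finset.sum_congr rfl fun i _ => ?_
  rw [map_smul, map_smul, smul_eq_mul, mul_comm]
  rfl

theorem tensor_eq_sum {x y : N} (hy : y ∈ (chartAt H x).source)
    (B : LinearMap.BilinForm ℝ (Cotangent I y)) (α β : Cotangent I y) :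
    B α β = ∑ i, ∑ j, α (coordVec I x y i) * β (coordVec I x y j)
      * B (coordForm I x y i) (coordForm I x y j) := by
  conv_lhs => rw [covector_eq_sum hy α, covector_eq_sum hy β]
  simp only [map_sum, map_smul, LinearMap.sum_apply, LinearMap.smul_apply, smul_eq_mul,
    Finset.mul_sum]
  rw [Finset.sum_comm]
  refine Finset.sum_congr rfl fun i _ => Finset.sum_congr rfl fun j _ => ?_
  ring

theorem contMDiffAt_coordVec {α : OneForm I N} {x : N} (hα : SmoothFormAt I α x)
    (i : Fin (Module.finrank ℝ E)) :
    ContMDiffAt I 𝓘(ℝ, ℝ) ∞ (fun y => α y (coordVec I x y i)) x :=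
  contMDiffAt_bilin (ContinuousLinearMap.id ℝ (E →L[ℝ] ℝ))
    (f := fun y => (α y).comp (ofCoord I x y)) hα (contMDiffAt_const (c := Module.finBasis ℝ E i))

theorem mvfderiv_coordVec {α : OneForm I N} {x : N} (hα : SmoothFormAt I α x)
    (i : Fin (Module.finrank ℝ E)) (v : TangentSpace I x) :
    mvfderiv I (fun y => α y (coordVec I x y i)) x v
      = partialForm I α x v (coordVec I x x i) := by
  have h := mvfderiv_bilin (ContinuousLinearMap.id ℝ (E →L[ℝ] ℝ))
    (mdifferentiableAt_of_contMDiffAt hα)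
    (mdifferentiableAt_of_contMDiffAt (contMDiffAt_const (c := Module.finBasis ℝ E i))) v
  refine h.trans ?_
  rw [(HasVDeriv.const _ _).mvfderiv_eq]
  simp only [partialForm, coordVec, ContinuousLinearMap.comp_apply,
    toCoord_ofCoord (mem_chart_source H x)]
  simp

theorem tensor_apply_eventuallyEq (Q : Tensor2 I N) (α β : OneForm I N) (x : N) :
    (fun y => Q y (α y) (β y)) =ᶠ[𝓝 x] fun y => ∑ i, ∑ j,
      α y (coordVec I x y i) * β y (coordVec I x y j)
        * Q y (coordForm I x y i) (coordForm I x y j) := by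
  filter_upwards [eventually_mem_chart_source (H := H) x] with y hy
  exact tensor_eq_sum hy (Q y) (α y) (β y)

theorem contMDiffAt_tensor_apply {Q : Tensor2 I N} {α β : OneForm I N} {x : N}
    (hQ : SmoothTensorAt I Q x) (hα : SmoothFormAt I α x) (hβ : SmoothFormAt I β x) :
    ContMDiffAt I 𝓘(ℝ, ℝ) ∞ (fun y => Q y (α y) (β y)) x := by
  refine ContMDiffAt.congr_of_eventuallyEq ?_ (tensor_apply_eventuallyEq Q α β x)
  refine ContMDiffAt.sum fun i _ => ContMDiffAt.sum fun j _ => ?_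
  exact ((contMDiffAt_coordVec hα i).mul (contMDiffAt_coordVec hβ j)).mul (hQ i j)

theorem mvfderiv_tensor_apply {Q : Tensor2 I N} {α β : OneForm I N} {x : N}
    (hQ : SmoothTensorAt I Q x) (hα : SmoothFormAt I α x) (hβ : SmoothFormAt I β x)
    (v : TangentSpace I x) :
    mvfderiv I (fun y => Q y (α y) (β y)) x v
      = coordDeriv I Q x v (α x) (β x) + Q x (partialForm I α x v) (β x)
        + Q x (α x) (partialForm I β x v) := by
  have ha := fun i => contMDiffAt_coordVec hα i
  have hb := fun i => contMDiffAt_coordVec hβ i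
  have hab : ∀ i j, ContMDiffAt I 𝓘(ℝ, ℝ) ∞
      (fun y => α y (coordVec I x y i) * β y (coordVec I x y j)) x := fun i j => (ha i).mul (hb j)
  have habQ : ∀ i j, ContMDiffAt I 𝓘(ℝ, ℝ) ∞
      (fun y => α y (coordVec I x y i) * β y (coordVec I x y j)
        * Q y (coordForm I x y i) (coordForm I x y j)) x := fun i j => (hab i j).mul (hQ i j)
  rw [mvfderiv_congr_of_eventuallyEq (tensor_apply_eventuallyEq Q α β x),
    tensor_eq_sum (mem_chart_source H x) (Q x) (partialForm I α x v),
    tensor_eq_sum (mem_chart_source H x) (Q x) (α x),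
    mvfderiv_sum _ fun i _ => mdifferentiableAt_of_contMDiffAt
      (ContMDiffAt.sum fun j _ => habQ i j)]
  simp only [coordDeriv, LinearMap.mk₂_apply, ← Finset.sum_add_distrib]
  refine Finset.sum_congr rfl fun i _ => ?_
  rw [mvfderiv_sum _ fun j _ => mdifferentiableAt_of_contMDiffAt (habQ i j)]
  refine Finset.sum_congr rfl fun j _ => ?_
  rw [mvfderiv_real_mul (mdifferentiableAt_of_contMDiffAt (hab i j))
      (mdifferentiableAt_of_contMDiffAt (hQ i j)),
    mvfderiv_real_mul (mdifferentiableAt_of_contMDiffAt (ha i))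
      (mdifferentiableAt_of_contMDiffAt (hb j)),
    mvfderiv_coordVec hα, mvfderiv_coordVec hβ]
  ring

end

variable [I.Boundaryless] [IsManifold I ∞ N]

theorem smoothFormAt_mvfderiv {f : N → ℝ} {x : N} (h : ContMDiffAt I 𝓘(ℝ, ℝ) ∞ f x) :
    SmoothFormAt I (mvfderiv I f) x :=
  contMDiffAt_mvfderiv_comp_ofCoord h

/-- The derivative of `df` along `X` is `d(X f) - df ∘ ∂X`. -/
theorem partialForm_mvfderiv {f : N → ℝ} {X : VField I N} {x : N}
    (h : ContMDiffAt I 𝓘(ℝ, ℝ) ∞ f x) (hX : SmoothFieldAt I X x) :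
    partialForm I (mvfderiv I f) x (X x)
      = mvfderiv I (fun y => mvfderiv I f y (X y)) x - (mvfderiv I f x).comp (jacobian I X x) := by
  ext v
  have h1 := mvfderiv_pairing (smoothFormAt_mvfderiv h) hX v
  have h2 := mvfderiv_mvfderiv_symm h (X x) v
  have h3 : partialForm I (mvfderiv I f) x (X x) v = partialForm I (mvfderiv I f) x v (X x) := h2
  rw [h3, _root_.sub_apply, h1]
  simp

theorem lieDeriv_apply_mvfderiv [FiniteDimensional ℝ E] {Q : Tensor2 I N} {X : VField I N}
    {f g : N → ℝ} {x : N} (hQ : SmoothTensorAt I Q x) (hX : SmoothFieldAt I X x)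
    (hf : ContMDiffAt I 𝓘(ℝ, ℝ) ∞ f x) (hg : ContMDiffAt I 𝓘(ℝ, ℝ) ∞ g x) :
    lieDeriv I X Q x (mvfderiv I f x) (mvfderiv I g x)
      = mvfderiv I (bracket I Q f g) x (X x)
        - bracket I Q (fun y => mvfderiv I f y (X y)) g x
        - bracket I Q f (fun y => mvfderiv I g y (X y)) x := by
  have h := mvfderiv_tensor_apply hQ (smoothFormAt_mvfderiv hf) (smoothFormAt_mvfderiv hg) (X x)
  rw [partialForm_mvfderiv hf hX, partialForm_mvfderiv hg hX] at h
  simp only [map_sub, LinearMap.sub_apply] at h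
  have h' : mvfderiv I (bracket I Q f g) x (X x) = _ := h
  rw [h']
  simp only [lieDeriv, bracket, LinearMap.sub_apply, actEnd_apply]
  ring

end TensorCalculus

section VectorFields

variable {E : Type*} [NormedAddCommGroup E] [NormedSpace ℝ E]
  {H : Type*} [TopologicalSpace H] {I : ModelWithCorners ℝ E H}
  {N : Type*} [TopologicalSpace N] [ChartedSpace H N]

section

variable [IsManifold I 1 N]

theorem smoothFieldAt_iff {X : VField I N} {x : N} :
    SmoothFieldAt I X x ↔ ContMDiffAt I (I.prod 𝓘(ℝ, E)) ∞
      (fun y => (TotalSpace.mk' E y (X y) : TangentBundle I N)) x := by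
  rw [contMDiffAt_section]
  refine Filter.EventuallyEq.contMDiffAt_iff ?_
  filter_upwards [eventually_mem_chart_source (H := H) x] with y hy
  exact Trivialization.coe_linearMapAt_of_mem (R := ℝ) (trivializationAt E (TangentSpace I) x) hy
    ▸ rfl

theorem SmoothFieldAt.mdifferentiableAt {X : VField I N} {x : N} (hX : SmoothFieldAt I X x) :
    MDifferentiableAt I (I.prod 𝓘(ℝ, E))
      (fun y => (TotalSpace.mk' E y (X y) : TangentBundle I N)) x :=
  (smoothFieldAt_iff.1 hX).mdifferentiableAt (by simp)

theorem toCoord_constField_eventuallyEq (x : N) (e : TangentSpace I x) :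
    (fun y => toCoord I x y (constField I x e y)) =ᶠ[𝓝 x] fun _ => toCoord I x x e := by
  filter_upwards [eventually_mem_chart_source (H := H) x] with y hy
  exact toCoord_ofCoord hy _

theorem smoothFieldAt_constField (x : N) (e : TangentSpace I x) :
    SmoothFieldAt I (constField I x e) x :=
  contMDiffAt_const.congr_of_eventuallyEq (toCoord_constField_eventuallyEq x e)

theorem constField_self (x : N) (e : TangentSpace I x) : constField I x e x = e :=
  ofCoord_toCoord (mem_chart_source H x) e

/-! ### Test functions -/

variable (I) in
/-- Near `x`, all linear functions of the preferred chart at `x` belong to `𝓕`. -/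
def HasCoordFunctions (𝓕 : Set (N → ℝ)) (x : N) : Prop :=
  ∀ ℓ : E →L[ℝ] ℝ, ∃ h ∈ 𝓕, h =ᶠ[𝓝 x] fun y => ℓ (extChartAt I x y)

theorem mvfderiv_coordFunction {h : N → ℝ} {ℓ : E →L[ℝ] ℝ} {x : N}
    (hh : h =ᶠ[𝓝 x] fun y => ℓ (extChartAt I x y)) :
    ∀ᶠ y in 𝓝 x, mvfderiv I h y = ℓ.comp (toCoord I x y) := by
  filter_upwards [hh.eventuallyEq_nhds, eventually_mem_chart_source (H := H) x] with y hy hy'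
  rw [mvfderiv_congr_of_eventuallyEq hy]
  ext v
  exact mvfderiv_comp_extChartAt hy' ℓ v

variable [FiniteDimensional ℝ E]

theorem smoothFieldAt_of_coordFunctions {X : VField I N} {x : N} {𝓕 : Set (N → ℝ)}
    (hF : HasCoordFunctions I 𝓕 x)
    (hX : ∀ f ∈ 𝓕, ContMDiffAt I 𝓘(ℝ, ℝ) ∞ (fun y => mvfderiv I f y (X y)) x) :
    SmoothFieldAt I X x := by
  have h1 : ∀ i, ContMDiffAt I 𝓘(ℝ, ℝ) ∞
      (fun y => (Module.finBasis ℝ E).coord i (toCoord I x y (X y))) x := by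
    intro i
    obtain ⟨h, hh, he⟩ := hF (LinearMap.toContinuousLinearMap ((Module.finBasis ℝ E).coord i))
    refine (hX h hh).congr_of_eventuallyEq ?_
    filter_upwards [mvfderiv_coordFunction he] with y hy
    rw [hy]
    rfl
  have h2 : ∀ y, toCoord I x y (X y)
      = ∑ i, (Module.finBasis ℝ E).coord i (toCoord I x y (X y)) • Module.finBasis ℝ E i :=
    fun y => ((Module.finBasis ℝ E).sum_repr _).symm
  unfold SmoothFieldAt
  rw [funext h2]
  exact ContMDiffAt.sum fun i _ => (h1 i).smul contMDiffAt_const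

theorem smoothTensorAt_of_coordFunctions {Q : Tensor2 I N} {x : N} {𝓕 : Set (N → ℝ)}
    (hF : HasCoordFunctions I 𝓕 x)
    (hQ : ∀ f ∈ 𝓕, ∀ g ∈ 𝓕, ContMDiffAt I 𝓘(ℝ, ℝ) ∞ (bracket I Q f g) x) :
    SmoothTensorAt I Q x := by
  intro i j
  obtain ⟨f, hf, hfe⟩ := hF (LinearMap.toContinuousLinearMap ((Module.finBasis ℝ E).coord i))
  obtain ⟨g, hg, hge⟩ := hF (LinearMap.toContinuousLinearMap ((Module.finBasis ℝ E).coord j))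
  refine (hQ f hf g hg).congr_of_eventuallyEq ?_
  filter_upwards [mvfderiv_coordFunction hfe, mvfderiv_coordFunction hge] with y hy hy'
  simp only [bracket, hy, hy']
  rfl

end

variable [I.Boundaryless] [IsManifold I ∞ N]

theorem contMDiffAt_mvfderiv_apply {f : N → ℝ} {X : VField I N} {x : N}
    (hf : ContMDiffAt I 𝓘(ℝ, ℝ) ∞ f x) (hX : SmoothFieldAt I X x) :
    ContMDiffAt I 𝓘(ℝ, ℝ) ∞ (fun y => mvfderiv I f y (X y)) x :=
  contMDiffAt_pairing (smoothFormAt_mvfderiv hf) hX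

theorem contMDiffAt_bracket [FiniteDimensional ℝ E] {Q : Tensor2 I N} {f g : N → ℝ} {x : N}
    (hQ : SmoothTensorAt I Q x) (hf : ContMDiffAt I 𝓘(ℝ, ℝ) ∞ f x)
    (hg : ContMDiffAt I 𝓘(ℝ, ℝ) ∞ g x) :
    ContMDiffAt I 𝓘(ℝ, ℝ) ∞ (bracket I Q f g) x :=
  contMDiffAt_tensor_apply hQ (smoothFormAt_mvfderiv hf) (smoothFormAt_mvfderiv hg)

/-! ### The Lie bracket of vector fields -/

theorem mpullbackWithin_extChartAt_symm_eventuallyEq (X : VField I N) (x : N) :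
    mpullbackWithin 𝓘(ℝ, E) I (extChartAt I x).symm X (Set.range I) =ᶠ[𝓝 (extChartAt I x x)]
      fun u => toCoord I x ((extChartAt I x).symm u) (X ((extChartAt I x).symm u)) := by
  filter_upwards [extChartAt_target_mem_nhds (I := I) x] with u hu
  have hy : (extChartAt I x).symm u ∈ (chartAt H x).source := by
    rw [← extChartAt_source I]
    exact (extChartAt I x).map_target hu
  rw [mpullbackWithin_apply, toCoord_eq_mfderiv hy]
  have h := ContinuousLinearMap.inverse_eq
    (mfderivWithin_extChartAt_symm_comp_mfderiv_extChartAt (I := I) hu)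
    (mfderiv_extChartAt_comp_mfderivWithin_extChartAt_symm (I := I) hu)
  exact congrArg (fun L : TangentSpace I ((extChartAt I x).symm u) →L[ℝ] E =>
    L (X ((extChartAt I x).symm u))) h

theorem mlieBracket_eq_jacobian {X Y : VField I N} {x : N} (hX : SmoothFieldAt I X x)
    (hY : SmoothFieldAt I Y x) :
    mlieBracket I X Y x = jacobian I Y x (X x) - jacobian I X x (Y x) := by
  have h0 : (mfderiv I 𝓘(ℝ, E) (extChartAt I x) x).inverse
      = ContinuousLinearMap.id ℝ (TangentSpace I x) := by
    rw [mfderiv_extChartAt_self]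
    exact ContinuousLinearMap.inverse_id
  have h1 : ∀ X : VField I N, SmoothFieldAt I X x → ∀ v : TangentSpace I x,
      fderiv ℝ (fun u => toCoord I x ((extChartAt I x).symm u) (X ((extChartAt I x).symm u)))
        (extChartAt I x x) v = jacobian I X x v := by
    intro X hX v
    rw [jacobian_apply, ofCoord_self]
    exact (mvfderiv_eq_fderiv (mdifferentiableAt_of_contMDiffAt hX) v).symm
  have h2 : ∀ X : VField I N, toCoord I x ((extChartAt I x).symm (extChartAt I x x))
      (X ((extChartAt I x).symm (extChartAt I x x))) = X x := by
    intro X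
    rw [extChartAt_to_inv]
    exact toCoord_self x (X x)
  rw [← mlieBracketWithin_univ, mlieBracketWithin_apply, h0, Set.preimage_univ, Set.univ_inter,
    Filter.EventuallyEq.lieBracketWithin_vectorField_eq_nhds
      (mpullbackWithin_extChartAt_symm_eventuallyEq X x)
      (mpullbackWithin_extChartAt_symm_eventuallyEq Y x),
    I.range_eq_univ, lieBracketWithin_univ, lieBracket_eq]
  have h3 : jacobian I Y x (X x) - jacobian I X x (Y x) = _ :=
    congrArg₂ (fun a b : E => a - b) (h1 Y hY (X x)).symm (h1 X hX (Y x)).symm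
  rw [h3]
  simp only [h2]
  rfl

theorem mvfderiv_mlieBracket {X Y : VField I N} {x : N} {f : N → ℝ}
    (hf : ContMDiffAt I 𝓘(ℝ, ℝ) ∞ f x) (hX : SmoothFieldAt I X x)
    (hY : SmoothFieldAt I Y x) :
    mvfderiv I f x (mlieBracket I X Y x)
      = mvfderiv I (fun y => mvfderiv I f y (Y y)) x (X x)
        - mvfderiv I (fun y => mvfderiv I f y (X y)) x (Y x) := by
  rw [mvfderiv_pairing (smoothFormAt_mvfderiv hf) hX, mvfderiv_pairing (smoothFormAt_mvfderiv hf) hY,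
    mlieBracket_eq_jacobian hX hY, map_sub]
  have h : partialForm I (mvfderiv I f) x (X x) (Y x)
    = partialForm I (mvfderiv I f) x (Y x) (X x) := mvfderiv_mvfderiv_symm hf (X x) (Y x)
  rw [h]
  ring

end VectorFields

section Connection

variable {E : Type*} [NormedAddCommGroup E] [NormedSpace ℝ E]
  {H : Type*} [TopologicalSpace H] {I : ModelWithCorners ℝ E H}
  {N : Type*} [TopologicalSpace N] [ChartedSpace H N] [IsManifold I 1 N]
  (nabla : CovariantDerivative I E (TangentSpace I : N → Type _))

theorem nabla_sum {ι : Type*} (s : Finset ι) {X : ι → VField I N} {x : N}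
    (hX : ∀ i, SmoothFieldAt I (X i) x) :
    nabla (fun y => ∑ i ∈ s, X i y) x = ∑ i ∈ s, nabla (X i) x := by
  classical
  induction s using Finset.induction_on with
  | empty => exact nabla.isCovariantDerivativeOnUniv.zero
  | insert a s ha ih =>
    rw [Finset.sum_insert ha, ← ih]
    have h := nabla.isCovariantDerivativeOnUniv.add (hX a).mdifferentiableAt
      (MDifferentiableAt.sum_section (s := s) fun i _ => (hX i).mdifferentiableAt)
    refine Eq.trans ?_ h
    congr 1
    funext y
    exact Finset.sum_insert ha

variable [FiniteDimensional ℝ E]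

theorem vectorField_eventuallyEq_sum (X : VField I N) (x : N) :
    ∀ᶠ y in 𝓝 x, X y = ∑ i, (coordForm I x y i (X y)) • constField I x (coordVec I x x i) y := by
  filter_upwards [eventually_mem_chart_source (H := H) x] with y hy
  have h := (Module.finBasis ℝ E).sum_repr (toCoord I x y (X y))
  conv_lhs => rw [← ofCoord_toCoord hy (X y), ← h, map_sum]
  refine Finset.sum_congr rfl fun i _ => ?_
  rw [map_smul, constField, coordVec, toCoord_ofCoord (mem_chart_source H x)]
  rfl

/-- In the preferred chart at `x`, `∇_v X = v(X^i) ∂_i + X^i ∇_v ∂_i`. -/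
theorem nabla_eq_jacobian_add_christoffel {X : VField I N} {x : N} (hX : SmoothFieldAt I X x)
    (v : TangentSpace I x) :
    nabla X x v = jacobian I X x v + christoffel I nabla x v (X x) := by
  set c : Fin (Module.finrank ℝ E) → N → ℝ := fun i y => coordForm I x y i (X y) with hc
  set B : Fin (Module.finrank ℝ E) → VField I N := fun i => constField I x (coordVec I x x i)
    with hB
  have hcs : ∀ i, ContMDiffAt I 𝓘(ℝ, ℝ) ∞ (c i) x := fun i =>
    (LinearMap.toContinuousLinearMap ((Module.finBasis ℝ E).coord i)).contMDiff.contMDiffAt.comp x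
      hX
  have hcd := fun i => mdifferentiableAt_of_contMDiffAt (hcs i)
  have hBs : ∀ i, SmoothFieldAt I (B i) x := fun i => smoothFieldAt_constField x _
  have hS : ∀ i, SmoothFieldAt I (c i • B i) x := by
    intro i
    have h := (hcs i).smul (hBs i)
    refine h.congr_of_eventuallyEq (Filter.Eventually.of_forall fun y => ?_)
    exact map_smul (toCoord I x y) (c i y) (B i y)
  have h1 : nabla X x = nabla (fun y => ∑ i, (c i • B i) y) x :=
    nabla.isCovariantDerivativeOnUniv.congr_of_eventuallyEq hX.mdifferentiableAt
      (MDifferentiableAt.sum_section (s := Finset.univ) fun i _ => (hS i).mdifferentiableAt)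
      Filter.univ_mem (vectorField_eventuallyEq_sum X x)
  have h2 : ∀ i, nabla (c i • B i) x v
      = c i x • nabla (B i) x v + mvfderiv I (c i) x v • B i x := by
    intro i
    rw [nabla.isCovariantDerivativeOnUniv.leibniz (hBs i).mdifferentiableAt (hcd i)]
    rfl
  have h3 : ∀ i, mvfderiv I (c i) x v = coordForm I x x i (jacobian I X x v) := by
    intro i
    have h := mvfderiv_comp_fderiv (mdifferentiableAt_of_contMDiffAt hX)
      (LinearMap.toContinuousLinearMap ((Module.finBasis ℝ E).coord i)).hasFDerivAt v
    refine h.trans ?_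
    rw [jacobian_apply, coordForm, ContinuousLinearMap.comp_apply,
      toCoord_ofCoord (mem_chart_source H x)]
  have h4 : ∀ u : TangentSpace I x, u = ∑ i, coordForm I x x i u • B i x := by
    intro u
    have h := (vectorField_eventuallyEq_sum (constField I x u) x).self_of_nhds
    rwa [constField_self] at h
  rw [h1, nabla_sum nabla _ hS, sum_apply]
  simp only [h2, h3, Finset.sum_add_distrib]
  rw [← h4, add_comm]
  congr 1
  conv_rhs => rw [h4 (X x), map_sum]
  refine Finset.sum_congr rfl fun i _ => ?_
  have hBx : B i x = coordVec I x x i := constField_self _ _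
  rw [map_smul, christoffel_apply, hBx]

theorem mvfderiv_pairing_nabla {α : OneForm I N} {X : VField I N} {x : N}
    (hα : SmoothFormAt I α x) (hX : SmoothFieldAt I X x) (v : TangentSpace I x) :
    mvfderiv I (fun y => α y (X y)) x v
      = nablaForm I nabla α x v (X x) + α x (nabla X x v) := by
  have h : nablaForm I nabla α x v
    = partialForm I α x v - (α x).comp (christoffel I nabla x v) := rfl
  rw [mvfderiv_pairing hα hX, nabla_eq_jacobian_add_christoffel nabla hX, h, map_add,
    _root_.sub_apply, ContinuousLinearMap.comp_apply]
  ring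

theorem mvfderiv_tensor_apply_nabla {Q : Tensor2 I N} {α β : OneForm I N} {x : N}
    (hQ : SmoothTensorAt I Q x) (hα : SmoothFormAt I α x) (hβ : SmoothFormAt I β x)
    (v : TangentSpace I x) :
    mvfderiv I (fun y => Q y (α y) (β y)) x v
      = nablaTensor I nabla Q x v (α x) (β x) + Q x (nablaForm I nabla α x v) (β x)
        + Q x (α x) (nablaForm I nabla β x v) := by
  have h : ∀ α : OneForm I N, nablaForm I nabla α x v
    = partialForm I α x v - (α x).comp (christoffel I nabla x v) := fun _ => rfl
  rw [mvfderiv_tensor_apply hQ hα hβ, h, h, nablaTensor]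
  simp only [LinearMap.add_apply, actEnd_apply, map_sub, LinearMap.sub_apply]
  ring

end Connection

section BaseManifold

variable {E : Type*} [NormedAddCommGroup E] [NormedSpace ℝ E] [FiniteDimensional ℝ E]
  {H : Type*} [TopologicalSpace H] {I : ModelWithCorners ℝ E H}
  {M : Type*} [TopologicalSpace M] [ChartedSpace H M] [IsManifold I ∞ M]

/-! ### Smooth global extensions -/

theorem hasCoordFunctions_smoothFun [T2Space M] (x : M) :
    HasCoordFunctions I {f : M → ℝ | SmoothFun I f} x := by
  intro ℓ
  let ρ : SmoothBumpFunction I x := Classical.arbitrary _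
  refine ⟨fun y => ρ y • ℓ (extChartAt I x y), ?_, ?_⟩
  · exact ρ.contMDiff_smul fun y hy =>
      (ℓ.contMDiff.contMDiffAt.comp y (contMDiffAt_extChartAt' hy)).contMDiffWithinAt
  · filter_upwards [ρ.eventuallyEq_one] with y hy
    simp [hy]

omit [FiniteDimensional ℝ E] in
theorem smoothVField_iff {X : VField I M} : SmoothVField I X ↔ ∀ x, SmoothFieldAt I X x :=
  forall_congr' fun _ => smoothFieldAt_iff.symm

omit [FiniteDimensional ℝ E] in
theorem ofCoord_smooth {x y : M} (hy : y ∈ (chartAt H x).source) (e : E) :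
    ContMDiffAt I (I.prod 𝓘(ℝ, E)) ∞
      (fun z => (TotalSpace.mk' E z (ofCoord I x z e) : TangentBundle I M)) y := by
  rw [Trivialization.contMDiffAt_section_iff (trivializationAt E (TangentSpace I) x) hy]
  refine (contMDiffAt_const (c := e)).congr_of_eventuallyEq ?_
  filter_upwards [(chartAt H x).open_source.mem_nhds hy] with z hz
  have h := toCoord_ofCoord (I := I) hz e
  rw [toCoord, Trivialization.continuousLinearMapAt_apply,
    Trivialization.coe_linearMapAt_of_mem _ hz] at h
  exact h

theorem exists_smoothVField_eventuallyEq_ofCoord [T2Space M] (x : M) (e : E) :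
    ∃ X : VField I M, SmoothVField I X ∧ ∀ᶠ y in 𝓝 x, X y = ofCoord I x y e := by
  let ρ : SmoothBumpFunction I x := Classical.arbitrary _
  refine ⟨fun y => ρ y • ofCoord I x y e, fun y => ?_, ?_⟩
  · by_cases hy : y ∈ (chartAt H x).source
    · exact ContMDiffAt.smul_section ρ.contMDiffAt (ofCoord_smooth hy e)
    · have h1 : ∀ᶠ z in 𝓝 y, z ∉ tsupport ρ :=
        (isClosed_tsupport ρ).isOpen_compl.mem_nhds
          fun h => hy (ρ.tsupport_subset_chartAt_source h)
      refine (contMDiff_zeroSection ℝ (TangentSpace I : M → Type _) y).congr_of_eventuallyEq ?_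
      filter_upwards [h1] with z hz
      simp only [image_eq_zero_of_notMem_tsupport hz, zero_smul]
      rfl
  · filter_upwards [ρ.eventuallyEq_one] with y hy
    simp [hy]

omit [FiniteDimensional ℝ E] in
theorem SmoothOneForm.smoothFormAt {α : OneForm I M} (hα : SmoothOneForm I α) (x : M) :
    SmoothFormAt I α x := by
  have h := ((contMDiffAt_hom_bundle _).1 (hα x)).2
  refine h.congr_of_eventuallyEq (Filter.Eventually.of_forall fun y => ?_)
  ext e
  simp [ContinuousLinearMap.inCoordinates, ofCoord]

theorem smoothTensorAt_of_bracket [T2Space M] {Q : Tensor2 I M}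
    (hQ : ∀ f g : M → ℝ, SmoothFun I f → SmoothFun I g → SmoothFun I (bracket I Q f g)) (x : M) :
    SmoothTensorAt I Q x :=
  smoothTensorAt_of_coordFunctions (hasCoordFunctions_smoothFun x)
    fun f hf g hg => hQ f g hf hg x

theorem smoothVField_of_mvfderiv [T2Space M] {X : VField I M}
    (hX : ∀ f : M → ℝ, SmoothFun I f → SmoothFun I fun y => mvfderiv I f y (X y)) :
    SmoothVField I X :=
  smoothVField_iff.2 fun x => smoothFieldAt_of_coordFunctions (hasCoordFunctions_smoothFun x)
    fun f hf => hX f hf x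

theorem exists_smoothFun_mvfderiv_eq [T2Space M] (x : M) (α : Cotangent I x) :
    ∃ f : M → ℝ, SmoothFun I f ∧ mvfderiv I f x = α := by
  obtain ⟨f, hf, h⟩ := hasCoordFunctions_smoothFun (I := I) x (α.comp (ofCoord I x x))
  refine ⟨f, hf, ?_⟩
  rw [(mvfderiv_coordFunction h).self_of_nhds]
  ext v
  exact congrArg α (ofCoord_toCoord (mem_chart_source H x) v)

variable [I.Boundaryless]

omit [FiniteDimensional ℝ E] in
theorem smoothFun_mvfderiv_apply {f : M → ℝ} {X : VField I M}
    (hf : SmoothFun I f) (hX : SmoothVField I X) :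
    SmoothFun I (fun y => mvfderiv I f y (X y)) :=
  fun x => contMDiffAt_mvfderiv_apply (hf x) (smoothVField_iff.1 hX x)

theorem smoothVField_mlieBracket [T2Space M] {X Y : VField I M} (hX : SmoothVField I X)
    (hY : SmoothVField I Y) : SmoothVField I (mlieBracket I X Y) := by
  refine smoothVField_of_mvfderiv fun f hf => ?_
  have h : (fun y => mvfderiv I f y (mlieBracket I X Y y)) = fun y =>
      mvfderiv I (fun y => mvfderiv I f y (Y y)) y (X y)
        - mvfderiv I (fun y => mvfderiv I f y (X y)) y (Y y) :=
    funext fun y => mvfderiv_mlieBracket (hf y) (smoothVField_iff.1 hX y) (smoothVField_iff.1 hY y)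
  rw [h]
  exact (smoothFun_mvfderiv_apply (smoothFun_mvfderiv_apply hf hY) hX).sub
    (smoothFun_mvfderiv_apply (smoothFun_mvfderiv_apply hf hX) hY)

/-! ### The contravariant derivative -/

variable {w : Tensor2 I M} (nabla : CovariantDerivative I E (TangentSpace I : M → Type _))

theorem smoothVField_sharp [T2Space M] {α : OneForm I M} (hw : IsBivectorField I w)
    (hα : ∀ x, SmoothFormAt I α x) : SmoothVField I (fun x => sharp (w x) (α x)) := by
  refine smoothVField_of_mvfderiv fun f hf x => ?_
  simp only [apply_sharp]
  exact contMDiffAt_tensor_apply (smoothTensorAt_of_bracket hw.smooth x) (hα x)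
    (smoothFormAt_mvfderiv (hf x))

omit [FiniteDimensional ℝ E] [I.Boundaryless] in
theorem smoothVField_nabla [CovariantDerivative.ContMDiffCovariantDerivative nabla ∞]
    {X Y : VField I M} (hX : SmoothVField I X) (hY : SmoothVField I Y) :
    SmoothVField I (fun x => nabla X x (Y x)) := by
  intro x
  have h := (CovariantDerivative.ContMDiffCovariantDerivative.contMDiff (cov := nabla)
    (k := ∞)).contMDiff (σ := X) (contMDiffOn_univ.2 hX)
  exact ContMDiffAt.clm_bundle_apply (contMDiffOn_univ.1 h x) (hY x)

/-- `(∇_v w)(α, β) = ⟨β, ∇_v α^♯⟩ + v⟨α, β^♯⟩ - ⟨α, ∇_v β^♯⟩` for a bivector field `w`. -/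
theorem nablaTensor_apply_eq [T2Space M] {α β : OneForm I M} (hw : IsBivectorField I w)
    (hα : ∀ x, SmoothFormAt I α x) (hβ : ∀ x, SmoothFormAt I β x) (x : M) (v : TangentSpace I x) :
    nablaTensor I nabla w x v (α x) (β x)
      = β x (nabla (fun y => sharp (w y) (α y)) x v)
        + mvfderiv I (fun y => α y (sharp (w y) (β y))) x v
        - α x (nabla (fun y => sharp (w y) (β y)) x v) := by
  have h1 := mvfderiv_tensor_apply_nabla nabla (smoothTensorAt_of_bracket hw.smooth x)
    (hα x) (hβ x) v
  have h2 := mvfderiv_pairing_nabla nabla (hα x)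
    (smoothVField_iff.1 (smoothVField_sharp hw hβ) x) v
  have h3 := mvfderiv_pairing_nabla nabla (hβ x)
    (smoothVField_iff.1 (smoothVField_sharp hw hα) x) v
  simp only [apply_sharp] at h2 h3 ⊢
  rw [hw.skew x (nablaForm I nabla α x v)] at h1
  linarith

theorem smoothVField_barD [T2Space M] [CovariantDerivative.ContMDiffCovariantDerivative nabla ∞]
    (hw : IsBivectorField I w) {α : OneForm I M} {X : VField I M} (hα : ∀ x, SmoothFormAt I α x)
    (hX : SmoothVField I X) : SmoothVField I (barD I w nabla α X) := by
  refine smoothVField_of_mvfderiv fun f hf => ?_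
  have hdf : ∀ x, SmoothFormAt I (mvfderiv I f) x := fun x => smoothFormAt_mvfderiv (hf x)
  have hα' := smoothVField_sharp hw hα
  have hf' := smoothVField_sharp hw hdf
  have pair : ∀ Y : VField I M, SmoothVField I Y → SmoothFun I (fun y => α y (Y y)) :=
    fun Y hY x => contMDiffAt_pairing (hα x) (smoothVField_iff.1 hY x)
  have h : (fun y => mvfderiv I f y (barD I w nabla α X y)) = fun y =>
      mvfderiv I f y (nabla X y (sharp (w y) (α y)))
      - (1 / 2 : ℝ) * (mvfderiv I f y (nabla (fun y => sharp (w y) (α y)) y (X y))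
        + mvfderiv I (fun y => α y (sharp (w y) (mvfderiv I f y))) y (X y)
        - α y (nabla (fun y => sharp (w y) (mvfderiv I f y)) y (X y))) := by
    funext y
    rw [← nablaTensor_apply_eq nabla hw hα hdf]
    simp only [barD, contraD, map_sub, map_smul, apply_sharp, smul_eq_mul]
  rw [h]
  refine ContMDiff.sub (smoothFun_mvfderiv_apply hf (smoothVField_nabla nabla hX hα'))
    (ContMDiff.mul contMDiff_const (ContMDiff.sub (ContMDiff.add ?_ ?_) ?_))
  · exact smoothFun_mvfderiv_apply hf (smoothVField_nabla nabla hα' hX)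
  · exact smoothFun_mvfderiv_apply (pair _ hf') hX
  · exact pair _ (smoothVField_nabla nabla hf' hX)

theorem isContravariantDerivative_barD [T2Space M]
    [CovariantDerivative.ContMDiffCovariantDerivative nabla ∞] (hw : IsBivectorField I w) :
    IsContravariantDerivative I w (barD I w nabla) where
  smooth α X hα hX := smoothVField_barD nabla hw hα.smoothFormAt hX
  add_form α α' X _ _ _ := by
    funext x
    simp only [barD, contraD, Pi.add_apply, sharp_add, map_add, smul_add]
    abel
  add_field α X X' _ hX hX' := by
    funext x
    have h := nabla.isCovariantDerivativeOnUniv.add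
      (smoothVField_iff.1 hX x).mdifferentiableAt (smoothVField_iff.1 hX' x).mdifferentiableAt
    have hs : sharp (nablaTensor I nabla w x (X x + X' x)) (α x)
        = sharp (nablaTensor I nabla w x (X x)) (α x)
          + sharp (nablaTensor I nabla w x (X' x)) (α x) := by
      simp only [sharp, nablaTensor_add, LinearMap.add_apply, LinearMap.add_comp, map_add]
    simp only [barD, contraD, Pi.add_apply, h, hs, _root_.add_apply, smul_add]
    abel
  smul_form f α X _ _ _ := by
    funext x
    simp only [barD, contraD, sharp_smul, map_smul, smul_sub]
    rw [smul_comm]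
  leibniz f α X hf _ hX := by
    funext x
    have h := nabla.isCovariantDerivativeOnUniv.leibniz
      (smoothVField_iff.1 hX x).mdifferentiableAt (mdifferentiableAt_of_contMDiffAt (hf x))
    have h' : nabla (fun x => f x • X x) x (sharp (w x) (α x))
        = f x • nabla X x (sharp (w x) (α x)) + mvfderiv I f x (sharp (w x) (α x)) • X x :=
      congrArg (fun L : TangentSpace I x →L[ℝ] TangentSpace I x => L (sharp (w x) (α x))) h
    have hs : sharp (nablaTensor I nabla w x (f x • X x)) (α x)
        = f x • sharp (nablaTensor I nabla w x (X x)) (α x) := by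
      simp only [sharp, nablaTensor_smul, LinearMap.smul_apply, LinearMap.smul_comp, map_smul]
    simp only [barD, contraD, h', hs, smul_sub]
    rw [smul_comm (1 / 2 : ℝ)]
    abel

omit [I.Boundaryless] in
theorem areDual_barDForm_barD : AreDual I w (barDForm I w nabla) (barD I w nabla) := by
  intro α β X hα hβ hX x
  rw [mvfderiv_pairing_nabla nabla (hβ.smoothFormAt x) (smoothVField_iff.1 hX x)]
  have h1 : nablaDot I w nabla α β x (X x) = nablaTensor I nabla w x (X x) (α x) (β x) := rfl
  simp only [barDForm, barD, contraD, contraDForm, _root_.add_apply, _root_.smul_apply, map_sub,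
    map_smul, apply_sharp, h1]
  ring

end BaseManifold

section CotangentBundleCalculus

variable {E : Type*} [NormedAddCommGroup E] [NormedSpace ℝ E] [FiniteDimensional ℝ E]
  {H : Type*} [TopologicalSpace H] {I : ModelWithCorners ℝ E H}
  {M : Type*} [TopologicalSpace M] [ChartedSpace H M] [IsManifold I ∞ M]
  {F : Type*} [NormedAddCommGroup F] [NormedSpace ℝ F]

/-! ### Calculus on the cotangent bundle -/

omit [FiniteDimensional ℝ E] in
theorem extChartAt_cotangentBundle (p q : CotangentBundle I M) :
    extChartAt (I.prod 𝓘(ℝ, E →L[ℝ] ℝ)) p q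
      = (extChartAt I p.1 q.1, (q.2).comp (ofCoord I p.1 q.1)) := by
  rw [FiberBundle.extChartAt]
  refine Prod.ext rfl ?_
  ext e
  simp [hom_trivializationAt_apply, ContinuousLinearMap.inCoordinates, ofCoord]

omit [FiniteDimensional ℝ E] in
theorem hasVDeriv_extChartAt_cotangentBundle (p : CotangentBundle I M) :
    HasVDeriv (I.prod 𝓘(ℝ, E →L[ℝ] ℝ)) (extChartAt (I.prod 𝓘(ℝ, E →L[ℝ] ℝ)) p) p
      (ContinuousLinearMap.id ℝ (E × (E →L[ℝ] ℝ))) := by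
  have h := (mdifferentiableAt_extChartAt (I := I.prod 𝓘(ℝ, E →L[ℝ] ℝ))
    (mem_chart_source _ p)).hasMFDerivAt
  rw [mfderiv_extChartAt_self] at h
  exact h

/-- The components `p_i` of covectors near `p`. -/
def fiberCoord (p q : CotangentBundle I M) : E →L[ℝ] ℝ := (q.2).comp (ofCoord I p.1 q.1)

omit [FiniteDimensional ℝ E] in
theorem hasVDeriv_fiberCoord (p : CotangentBundle I M) :
    HasVDeriv (I.prod 𝓘(ℝ, E →L[ℝ] ℝ)) (fiberCoord p) p
      (ContinuousLinearMap.snd ℝ E (E →L[ℝ] ℝ)) := by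
  have h := (hasVDeriv_extChartAt_cotangentBundle p).comp_fderiv
    (ContinuousLinearMap.snd ℝ E (E →L[ℝ] ℝ)).hasFDerivAt
  exact h.congr_of_eventuallyEq (Filter.Eventually.of_forall fun q =>
    (congrArg Prod.snd (extChartAt_cotangentBundle p q)).symm)

omit [FiniteDimensional ℝ E] in
theorem contMDiffAt_fiberCoord (p : CotangentBundle I M) :
    ContMDiffAt (I.prod 𝓘(ℝ, E →L[ℝ] ℝ)) 𝓘(ℝ, E →L[ℝ] ℝ) ∞ (fiberCoord p) p := by
  have h := (ContinuousLinearMap.snd ℝ E (E →L[ℝ] ℝ)).contMDiff.contMDiffAt.comp p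
    (contMDiffAt_extChartAt (I := I.prod 𝓘(ℝ, E →L[ℝ] ℝ)) (n := ∞) (x := p))
  exact h.congr_of_eventuallyEq (Filter.Eventually.of_forall fun q =>
    (congrArg Prod.snd (extChartAt_cotangentBundle p q)).symm)

omit [FiniteDimensional ℝ E] in
theorem mvfderiv_fiberCoord_baseVec (p : CotangentBundle I M) (e : E) :
    mvfderiv (I.prod 𝓘(ℝ, E →L[ℝ] ℝ)) (fiberCoord p) p (baseVec I p e) = 0 := by
  rw [(hasVDeriv_fiberCoord p).mvfderiv_eq]
  rfl

omit [FiniteDimensional ℝ E] in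
theorem mvfderiv_fiberCoord_fiberVec (p : CotangentBundle I M) (η : E →L[ℝ] ℝ) :
    mvfderiv (I.prod 𝓘(ℝ, E →L[ℝ] ℝ)) (fiberCoord p) p (fiberVec I p η) = η := by
  rw [(hasVDeriv_fiberCoord p).mvfderiv_eq]
  rfl

omit [FiniteDimensional ℝ E] in
theorem contMDiffAt_comp_proj {G : M → F} {p : CotangentBundle I M}
    (hG : ContMDiffAt I 𝓘(ℝ, F) ∞ G p.1) :
    ContMDiffAt (I.prod 𝓘(ℝ, E →L[ℝ] ℝ)) 𝓘(ℝ, F) ∞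
      (fun q : CotangentBundle I M => G q.1) p :=
  hG.comp p (contMDiffAt_proj (fun x : M => TangentSpace I x →L[ℝ] ℝ))

omit [FiniteDimensional ℝ E] in
theorem eventually_proj_mem_chart_source (p : CotangentBundle I M) :
    ∀ᶠ q : CotangentBundle I M in 𝓝 p, q.1 ∈ (chartAt H p.1).source :=
  (contMDiffAt_proj (IB := I) (n := ∞) (fun x : M => TangentSpace I x →L[ℝ] ℝ)
    (p := p)).continuousAt.eventually (eventually_mem_chart_source p.1)

omit [FiniteDimensional ℝ E] in
theorem hasVDeriv_comp_proj [I.Boundaryless] {G : M → F} {p : CotangentBundle I M}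
    {L : E →L[ℝ] F} (hG : HasVDeriv I G p.1 L) :
    HasVDeriv (I.prod 𝓘(ℝ, E →L[ℝ] ℝ)) (fun q : CotangentBundle I M => G q.1) p
      (L.comp (ContinuousLinearMap.fst ℝ E (E →L[ℝ] ℝ))) := by
  have h1 := (hasVDeriv_extChartAt_cotangentBundle p).comp_fderiv
    (ContinuousLinearMap.fst ℝ E (E →L[ℝ] ℝ)).hasFDerivAt
  have h2 : HasFDerivAt (fun u => G ((extChartAt I p.1).symm u)) L
      (ContinuousLinearMap.fst ℝ E (E →L[ℝ] ℝ)
        (extChartAt (I.prod 𝓘(ℝ, E →L[ℝ] ℝ)) p p)) := by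
    rw [extChartAt_cotangentBundle]
    exact hasFDerivAt_of_hasVDeriv hG
  refine (h1.comp_fderiv h2).congr_of_eventuallyEq ?_
  filter_upwards [eventually_proj_mem_chart_source p] with q hq
  rw [extChartAt_cotangentBundle]
  rw [← extChartAt_source I] at hq
  exact congrArg G ((extChartAt I p.1).left_inv hq).symm

omit [FiniteDimensional ℝ E] in
theorem mvfderiv_comp_proj_baseVec [I.Boundaryless] {G : M → F} {p : CotangentBundle I M}
    (hG : MDifferentiableAt I 𝓘(ℝ, F) G p.1) (v : TangentSpace I p.1) :
    mvfderiv (I.prod 𝓘(ℝ, E →L[ℝ] ℝ)) (fun q : CotangentBundle I M => G q.1) p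
      (baseVec I p (toCoord I p.1 p.1 v)) = mvfderiv I G p.1 v := by
  rw [(hasVDeriv_comp_proj (hasVDeriv_mvfderiv hG)).mvfderiv_eq]
  exact congrArg (mvfderiv I G p.1) (toCoord_self p.1 v)

omit [FiniteDimensional ℝ E] in
theorem mvfderiv_comp_proj_fiberVec [I.Boundaryless] {G : M → F} {p : CotangentBundle I M}
    (hG : MDifferentiableAt I 𝓘(ℝ, F) G p.1) (η : E →L[ℝ] ℝ) :
    mvfderiv (I.prod 𝓘(ℝ, E →L[ℝ] ℝ)) (fun q : CotangentBundle I M => G q.1) p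
      (fiberVec I p η) = 0 := by
  rw [(hasVDeriv_comp_proj (hasVDeriv_mvfderiv hG)).mvfderiv_eq]
  exact map_zero (mvfderiv I G p.1)

/-! #### Momenta of vector fields -/

omit [FiniteDimensional ℝ E] in
theorem momentum_eventuallyEq (X : VField I M) (p : CotangentBundle I M) :
    momentum I X =ᶠ[𝓝 p] fun q => fiberCoord p q (toCoord I p.1 q.1 (X q.1)) := by
  filter_upwards [eventually_proj_mem_chart_source p] with q hq
  exact congrArg q.2 (ofCoord_toCoord hq (X q.1)).symm

omit [FiniteDimensional ℝ E] in
theorem contMDiffAt_momentum {X : VField I M} {p : CotangentBundle I M}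
    (hX : SmoothFieldAt I X p.1) :
    ContMDiffAt (I.prod 𝓘(ℝ, E →L[ℝ] ℝ)) 𝓘(ℝ, ℝ) ∞ (momentum I X) p :=
  (contMDiffAt_bilin (ContinuousLinearMap.id ℝ (E →L[ℝ] ℝ)) (contMDiffAt_fiberCoord p)
    (contMDiffAt_comp_proj hX)).congr_of_eventuallyEq (momentum_eventuallyEq X p)

omit [FiniteDimensional ℝ E] in
theorem mvfderiv_momentum [I.Boundaryless] {X : VField I M} {p : CotangentBundle I M}
    (hX : SmoothFieldAt I X p.1) (V : TangentSpace (I.prod 𝓘(ℝ, E →L[ℝ] ℝ)) p) :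
    mvfderiv (I.prod 𝓘(ℝ, E →L[ℝ] ℝ)) (momentum I X) p V
      = mvfderiv (I.prod 𝓘(ℝ, E →L[ℝ] ℝ)) (fiberCoord p) p V (toCoord I p.1 p.1 (X p.1))
        + fiberCoord p p (mvfderiv (I.prod 𝓘(ℝ, E →L[ℝ] ℝ))
          (fun q : CotangentBundle I M => toCoord I p.1 q.1 (X q.1)) p V) := by
  rw [mvfderiv_congr_of_eventuallyEq (momentum_eventuallyEq X p)]
  exact mvfderiv_bilin (ContinuousLinearMap.id ℝ (E →L[ℝ] ℝ))
    (mdifferentiableAt_of_contMDiffAt (contMDiffAt_fiberCoord p))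
    (mdifferentiableAt_of_contMDiffAt (contMDiffAt_comp_proj hX)) V

omit [FiniteDimensional ℝ E] in
theorem mvfderiv_momentum_baseVec [I.Boundaryless] {X : VField I M} {p : CotangentBundle I M}
    (hX : SmoothFieldAt I X p.1) (v : TangentSpace I p.1) :
    mvfderiv (I.prod 𝓘(ℝ, E →L[ℝ] ℝ)) (momentum I X) p (baseVec I p (toCoord I p.1 p.1 v))
      = p.2 (jacobian I X p.1 v) := by
  rw [mvfderiv_momentum hX, mvfderiv_fiberCoord_baseVec,
    mvfderiv_comp_proj_baseVec (mdifferentiableAt_of_contMDiffAt hX)]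
  exact zero_add _

omit [FiniteDimensional ℝ E] in
theorem mvfderiv_momentum_fiberVec [I.Boundaryless] {X : VField I M} {p : CotangentBundle I M}
    (hX : SmoothFieldAt I X p.1) (η : E →L[ℝ] ℝ) :
    mvfderiv (I.prod 𝓘(ℝ, E →L[ℝ] ℝ)) (momentum I X) p (fiberVec I p η)
      = η (toCoord I p.1 p.1 (X p.1)) := by
  rw [mvfderiv_momentum hX, mvfderiv_fiberCoord_fiberVec,
    mvfderiv_comp_proj_fiberVec (mdifferentiableAt_of_contMDiffAt hX), map_zero, add_zero]

/-! #### Fiberwise quadratic functions -/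

theorem quad_eventuallyEq (Q : Tensor2 I M) (p : CotangentBundle I M) :
    quad I Q =ᶠ[𝓝 p] fun q => ∑ i, ∑ j,
      fiberCoord p q (Module.finBasis ℝ E i) * fiberCoord p q (Module.finBasis ℝ E j)
        * Q q.1 (coordForm I p.1 q.1 i) (coordForm I p.1 q.1 j) := by
  filter_upwards [eventually_proj_mem_chart_source p] with q hq
  exact tensor_eq_sum hq (Q q.1) q.2 q.2

omit [FiniteDimensional ℝ E] in
theorem contMDiffAt_fiberCoord_apply (p : CotangentBundle I M) (e : E) :
    ContMDiffAt (I.prod 𝓘(ℝ, E →L[ℝ] ℝ)) 𝓘(ℝ, ℝ) ∞ (fun q => fiberCoord p q e) p :=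
  contMDiffAt_bilin (ContinuousLinearMap.id ℝ (E →L[ℝ] ℝ)) (contMDiffAt_fiberCoord p)
    contMDiffAt_const

omit [FiniteDimensional ℝ E] in
theorem mvfderiv_fiberCoord_apply (p : CotangentBundle I M) (e : E)
    (V : TangentSpace (I.prod 𝓘(ℝ, E →L[ℝ] ℝ)) p) :
    mvfderiv (I.prod 𝓘(ℝ, E →L[ℝ] ℝ)) (fun q => fiberCoord p q e) p V
      = mvfderiv (I.prod 𝓘(ℝ, E →L[ℝ] ℝ)) (fiberCoord p) p V e :=
  mvfderiv_comp_fderiv (mdifferentiableAt_of_contMDiffAt (contMDiffAt_fiberCoord p))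
    (ContinuousLinearMap.apply ℝ ℝ e).hasFDerivAt V

theorem contMDiffAt_quad {Q : Tensor2 I M} {p : CotangentBundle I M}
    (hQ : SmoothTensorAt I Q p.1) :
    ContMDiffAt (I.prod 𝓘(ℝ, E →L[ℝ] ℝ)) 𝓘(ℝ, ℝ) ∞ (quad I Q) p := by
  refine ContMDiffAt.congr_of_eventuallyEq ?_ (quad_eventuallyEq Q p)
  refine ContMDiffAt.sum fun i _ => ContMDiffAt.sum fun j _ => ?_
  exact ((contMDiffAt_fiberCoord_apply p _).mul (contMDiffAt_fiberCoord_apply p _)).mul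
    (contMDiffAt_comp_proj (hQ i j))

theorem mvfderiv_quad {Q : Tensor2 I M} {p : CotangentBundle I M}
    (hQ : SmoothTensorAt I Q p.1) (V : TangentSpace (I.prod 𝓘(ℝ, E →L[ℝ] ℝ)) p) :
    mvfderiv (I.prod 𝓘(ℝ, E →L[ℝ] ℝ)) (quad I Q) p V
      = (∑ i, ∑ j,
        mvfderiv (I.prod 𝓘(ℝ, E →L[ℝ] ℝ)) (fun q : CotangentBundle I M =>
          Q q.1 (coordForm I p.1 q.1 i) (coordForm I p.1 q.1 j)) p V
        * (p.2 (coordVec I p.1 p.1 i) * p.2 (coordVec I p.1 p.1 j)))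
        + Q p.1 ((mvfderiv (I.prod 𝓘(ℝ, E →L[ℝ] ℝ)) (fiberCoord p) p V).comp
            (toCoord I p.1 p.1)) p.2
        + Q p.1 p.2 ((mvfderiv (I.prod 𝓘(ℝ, E →L[ℝ] ℝ)) (fiberCoord p) p V).comp
            (toCoord I p.1 p.1)) := by
  have ha := fun i => contMDiffAt_fiberCoord_apply p (Module.finBasis ℝ E i)
  have hab : ∀ i j, ContMDiffAt (I.prod 𝓘(ℝ, E →L[ℝ] ℝ)) 𝓘(ℝ, ℝ) ∞
      (fun q => fiberCoord p q (Module.finBasis ℝ E i) * fiberCoord p q (Module.finBasis ℝ E j))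
      p := fun i j => (ha i).mul (ha j)
  have hq : ∀ i j, ContMDiffAt (I.prod 𝓘(ℝ, E →L[ℝ] ℝ)) 𝓘(ℝ, ℝ) ∞
      (fun q : CotangentBundle I M => Q q.1 (coordForm I p.1 q.1 i) (coordForm I p.1 q.1 j)) p :=
    fun i j => contMDiffAt_comp_proj (hQ i j)
  have habq : ∀ i j, ContMDiffAt (I.prod 𝓘(ℝ, E →L[ℝ] ℝ)) 𝓘(ℝ, ℝ) ∞
      (fun q => fiberCoord p q (Module.finBasis ℝ E i) * fiberCoord p q (Module.finBasis ℝ E j)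
        * Q q.1 (coordForm I p.1 q.1 i) (coordForm I p.1 q.1 j)) p :=
    fun i j => (hab i j).mul (hq i j)
  have hv : ∀ i, (mvfderiv (I.prod 𝓘(ℝ, E →L[ℝ] ℝ)) (fiberCoord p) p V).comp
      (toCoord I p.1 p.1) (coordVec I p.1 p.1 i)
      = mvfderiv (I.prod 𝓘(ℝ, E →L[ℝ] ℝ)) (fiberCoord p) p V (Module.finBasis ℝ E i) := fun i =>
    congrArg _ (toCoord_ofCoord (mem_chart_source H p.1) _)
  have hp : ∀ i, p.2 (coordVec I p.1 p.1 i) = fiberCoord p p (Module.finBasis ℝ E i) :=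
    fun _ => rfl
  rw [mvfderiv_congr_of_eventuallyEq (quad_eventuallyEq Q p),
    tensor_eq_sum (mem_chart_source H p.1) (Q p.1) ((mvfderiv (I.prod 𝓘(ℝ, E →L[ℝ] ℝ))
      (fiberCoord p) p V).comp (toCoord I p.1 p.1)),
    tensor_eq_sum (mem_chart_source H p.1) (Q p.1) p.2,
    mvfderiv_sum _ fun i _ => mdifferentiableAt_of_contMDiffAt
      (ContMDiffAt.sum fun j _ => habq i j)]
  simp only [← Finset.sum_add_distrib]
  refine Finset.sum_congr rfl fun i _ => ?_
  rw [mvfderiv_sum _ fun j _ => mdifferentiableAt_of_contMDiffAt (habq i j)]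
  refine Finset.sum_congr rfl fun j _ => ?_
  rw [mvfderiv_real_mul (mdifferentiableAt_of_contMDiffAt (hab i j))
      (mdifferentiableAt_of_contMDiffAt (hq i j)),
    mvfderiv_real_mul (mdifferentiableAt_of_contMDiffAt (ha i))
      (mdifferentiableAt_of_contMDiffAt (ha j)),
    mvfderiv_fiberCoord_apply, mvfderiv_fiberCoord_apply, hv, hv, hp, hp]
  ring

theorem mvfderiv_quad_baseVec [I.Boundaryless] {Q : Tensor2 I M} {p : CotangentBundle I M}
    (hQ : SmoothTensorAt I Q p.1) (v : TangentSpace I p.1) :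
    mvfderiv (I.prod 𝓘(ℝ, E →L[ℝ] ℝ)) (quad I Q) p (baseVec I p (toCoord I p.1 p.1 v))
      = coordDeriv I Q p.1 v p.2 p.2 := by
  rw [mvfderiv_quad hQ, mvfderiv_fiberCoord_baseVec, ContinuousLinearMap.zero_comp, map_zero,
    map_zero, LinearMap.zero_apply, add_zero, add_zero]
  simp only [coordDeriv, LinearMap.mk₂_apply]
  refine Finset.sum_congr rfl fun i _ => Finset.sum_congr rfl fun j _ => ?_
  rw [mvfderiv_comp_proj_baseVec (mdifferentiableAt_of_contMDiffAt (hQ i j))]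

theorem mvfderiv_quad_fiberVec [I.Boundaryless] {Q : Tensor2 I M} {p : CotangentBundle I M}
    (hQ : SmoothTensorAt I Q p.1) (η : E →L[ℝ] ℝ) :
    mvfderiv (I.prod 𝓘(ℝ, E →L[ℝ] ℝ)) (quad I Q) p (fiberVec I p η)
      = Q p.1 (η.comp (toCoord I p.1 p.1)) p.2 + Q p.1 p.2 (η.comp (toCoord I p.1 p.1)) := by
  rw [mvfderiv_quad hQ, mvfderiv_fiberCoord_fiberVec]
  have h : ∀ i j, mvfderiv (I.prod 𝓘(ℝ, E →L[ℝ] ℝ)) (fun q : CotangentBundle I M =>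
      Q q.1 (coordForm I p.1 q.1 i) (coordForm I p.1 q.1 j)) p (fiberVec I p η) = 0 := fun i j =>
    mvfderiv_comp_proj_fiberVec (mdifferentiableAt_of_contMDiffAt (hQ i j)) η
  simp only [h, zero_mul, Finset.sum_const_zero, zero_add]

end CotangentBundleCalculus

section CanonicalPoisson

variable {E : Type*} [NormedAddCommGroup E] [NormedSpace ℝ E] [FiniteDimensional ℝ E]
  {H : Type*} [TopologicalSpace H] {I : ModelWithCorners ℝ E H}
  {M : Type*} [TopologicalSpace M] [ChartedSpace H M] [IsManifold I ∞ M]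

/-! ### Brackets of the canonical Poisson structure -/

theorem canonicalPoisson_skew (p : CotangentBundle I M)
    (Φ Ψ : Cotangent (I.prod 𝓘(ℝ, E →L[ℝ] ℝ)) p) :
    canonicalPoisson I p Φ Ψ = -canonicalPoisson I p Ψ Φ := by
  rw [canonicalPoisson_apply, canonicalPoisson_apply]
  ring

variable [I.Boundaryless]

omit [FiniteDimensional ℝ E] in
theorem bracket_canonicalPoisson_lift_lift {f g : M → ℝ} {p : CotangentBundle I M}
    (hf : ContMDiffAt I 𝓘(ℝ, ℝ) ∞ f p.1) (hg : ContMDiffAt I 𝓘(ℝ, ℝ) ∞ g p.1) :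
    bracket (I.prod 𝓘(ℝ, E →L[ℝ] ℝ)) (canonicalPoisson I) (lift I f) (lift I g) p = 0 := by
  have h1 := mvfderiv_comp_proj_fiberVec (mdifferentiableAt_of_contMDiffAt hf)
  have h2 := mvfderiv_comp_proj_fiberVec (mdifferentiableAt_of_contMDiffAt hg)
  exact (congrArg₂ (fun a b : ℝ => a - b) (h1 _) (h2 _)).trans (sub_zero 0)

omit [FiniteDimensional ℝ E] in
theorem bracket_canonicalPoisson_momentum_lift {X : VField I M} {f : M → ℝ}
    {p : CotangentBundle I M} (hX : SmoothFieldAt I X p.1)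
    (hf : ContMDiffAt I 𝓘(ℝ, ℝ) ∞ f p.1) :
    bracket (I.prod 𝓘(ℝ, E →L[ℝ] ℝ)) (canonicalPoisson I) (momentum I X) (lift I f) p
      = mvfderiv I f p.1 (X p.1) := by
  have h0 := mdifferentiableAt_of_contMDiffAt hf
  refine (congrArg₂ (fun a b : ℝ => a - b)
    ((mvfderiv_momentum_fiberVec hX _).trans (mvfderiv_comp_proj_baseVec h0 _))
    (mvfderiv_comp_proj_fiberVec h0 _)).trans (sub_zero _)

omit [FiniteDimensional ℝ E] in
theorem bracket_canonicalPoisson_momentum_momentum {X Y : VField I M}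
    {p : CotangentBundle I M} (hX : SmoothFieldAt I X p.1) (hY : SmoothFieldAt I Y p.1) :
    bracket (I.prod 𝓘(ℝ, E →L[ℝ] ℝ)) (canonicalPoisson I) (momentum I X) (momentum I Y) p
      = momentum I (mlieBracket I X Y) p := by
  rw [momentum, mlieBracket_eq_jacobian hX hY, map_sub]
  exact congrArg₂ (fun a b : ℝ => a - b)
    ((mvfderiv_momentum_fiberVec hX _).trans (mvfderiv_momentum_baseVec hY _))
    ((mvfderiv_momentum_fiberVec hY _).trans (mvfderiv_momentum_baseVec hX _))

theorem bracket_canonicalPoisson_momentum_quad {X : VField I M} {Q : Tensor2 I M}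
    {p : CotangentBundle I M} (hX : SmoothFieldAt I X p.1) (hQ : SmoothTensorAt I Q p.1) :
    bracket (I.prod 𝓘(ℝ, E →L[ℝ] ℝ)) (canonicalPoisson I) (momentum I X) (quad I Q) p
      = quad I (lieDeriv I X Q) p := by
  have h1 : ((mvfderiv (I.prod 𝓘(ℝ, E →L[ℝ] ℝ)) (momentum I X) p).comp (baseVec I p)).comp
      (toCoord I p.1 p.1) = (p.2 : Cotangent I p.1).comp (jacobian I X p.1) :=
    ContinuousLinearMap.ext fun v => mvfderiv_momentum_baseVec hX v
  have h2 := mvfderiv_quad_fiberVec hQ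
    ((mvfderiv (I.prod 𝓘(ℝ, E →L[ℝ] ℝ)) (momentum I X) p).comp (baseVec I p))
  rw [h1] at h2
  exact congrArg₂ (fun a b : ℝ => a - b)
    ((mvfderiv_momentum_fiberVec hX _).trans (mvfderiv_quad_baseVec hQ _)) h2

theorem bracket_canonicalPoisson_quad_lift {Q : Tensor2 I M} {f : M → ℝ}
    {p : CotangentBundle I M} (hQ : SmoothTensorAt I Q p.1)
    (hf : ContMDiffAt I 𝓘(ℝ, ℝ) ∞ f p.1) :
    bracket (I.prod 𝓘(ℝ, E →L[ℝ] ℝ)) (canonicalPoisson I) (quad I Q) (lift I f) p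
      = Q p.1 (mvfderiv I f p.1) p.2 + Q p.1 p.2 (mvfderiv I f p.1) := by
  have h0 := mdifferentiableAt_of_contMDiffAt hf
  have h1 : ((mvfderiv (I.prod 𝓘(ℝ, E →L[ℝ] ℝ)) (lift I f) p).comp (baseVec I p)).comp
      (toCoord I p.1 p.1) = mvfderiv I f p.1 :=
    ContinuousLinearMap.ext fun v => mvfderiv_comp_proj_baseVec h0 v
  have h2 := mvfderiv_quad_fiberVec hQ
    ((mvfderiv (I.prod 𝓘(ℝ, E →L[ℝ] ℝ)) (lift I f) p).comp (baseVec I p))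
  rw [h1] at h2
  exact (congrArg₂ (fun a b : ℝ => a - b) h2 (mvfderiv_comp_proj_fiberVec h0 _)).trans
    (sub_zero _)

/-! ### Functions affine in the momenta -/

variable (I M) in
/-- The functions on the cotangent bundle that are affine along the fibers. -/
def affineFunctions : Set (CotangentBundle I M → ℝ) :=
  {F | ∃ (f : M → ℝ) (X : VField I M), SmoothFun I f ∧ SmoothVField I X ∧
    F = fun q => lift I f q + momentum I X q}

omit [I.Boundaryless] in
theorem hasCoordFunctions_affineFunctions [T2Space M] (p : CotangentBundle I M) :
    HasCoordFunctions (I.prod 𝓘(ℝ, E →L[ℝ] ℝ)) (affineFunctions I M) p := by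
  intro ℓ
  obtain ⟨f, hf, hfe⟩ := hasCoordFunctions_smoothFun (I := I) p.1
    (ℓ.comp (ContinuousLinearMap.inl ℝ E (E →L[ℝ] ℝ)))
  let e : E := (Module.evalEquiv ℝ E).symm
    ((ℓ.comp (ContinuousLinearMap.inr ℝ E (E →L[ℝ] ℝ))).toLinearMap ∘ₗ
      (LinearMap.toContinuousLinearMap : (E →ₗ[ℝ] ℝ) ≃ₗ[ℝ] (E →L[ℝ] ℝ)).toLinearMap)
  have he : ∀ η : E →L[ℝ] ℝ, η e = ℓ (0, η) := fun η =>
    (Module.apply_evalEquiv_symm_apply ℝ E (η : E →ₗ[ℝ] ℝ) _).trans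
      (congrArg (fun η : E →L[ℝ] ℝ => ℓ (0, η)) (ContinuousLinearMap.ext fun _ => rfl))
  obtain ⟨X, hX, hXe⟩ := exists_smoothVField_eventuallyEq_ofCoord (I := I) p.1 e
  refine ⟨_, ⟨f, X, hf, hX, rfl⟩, ?_⟩
  have hπ : Filter.Tendsto (fun q : CotangentBundle I M => q.1) (𝓝 p) (𝓝 p.1) :=
    (contMDiffAt_proj (IB := I) (n := ∞) (fun x : M => TangentSpace I x →L[ℝ] ℝ)
      (p := p)).continuousAt
  filter_upwards [hπ.eventually hfe, hπ.eventually hXe] with q hq hq'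
  rw [extChartAt_cotangentBundle]
  have h1 : lift I f q = ℓ (extChartAt I p.1 q.1, 0) := hq
  have h2 : momentum I X q = ℓ (0, (q.2).comp (ofCoord I p.1 q.1)) := by
    rw [momentum, hq']
    exact he ((q.2).comp (ofCoord I p.1 q.1))
  rw [h1, h2, ← map_add]
  simp

omit [FiniteDimensional ℝ E] [I.Boundaryless] in
theorem smoothFun_lift {f : M → ℝ} (hf : SmoothFun I f) :
    SmoothFun (I.prod 𝓘(ℝ, E →L[ℝ] ℝ)) (lift I f) :=
  fun p => contMDiffAt_comp_proj (hf p.1)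

omit [FiniteDimensional ℝ E] [I.Boundaryless] in
theorem smoothFun_momentum {X : VField I M} (hX : SmoothVField I X) :
    SmoothFun (I.prod 𝓘(ℝ, E →L[ℝ] ℝ)) (momentum I X) :=
  fun p => contMDiffAt_momentum (smoothVField_iff.1 hX p.1)

omit [FiniteDimensional ℝ E] [I.Boundaryless] in
theorem mvfderiv_lift_add_momentum {f : M → ℝ} {X : VField I M} (hf : SmoothFun I f)
    (hX : SmoothVField I X) (p : CotangentBundle I M) :
    mvfderiv (I.prod 𝓘(ℝ, E →L[ℝ] ℝ)) (fun q => lift I f q + momentum I X q) p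
      = mvfderiv (I.prod 𝓘(ℝ, E →L[ℝ] ℝ)) (lift I f) p
        + mvfderiv (I.prod 𝓘(ℝ, E →L[ℝ] ℝ)) (momentum I X) p :=
  ((hasVDeriv_mvfderiv (mdifferentiableAt_of_contMDiffAt (smoothFun_lift hf p))).add
    (hasVDeriv_mvfderiv (mdifferentiableAt_of_contMDiffAt (smoothFun_momentum hX p)))).mvfderiv_eq

omit [I.Boundaryless] in
theorem exists_covector_eq [T2Space M] (p : CotangentBundle I M)
    (Φ : Cotangent (I.prod 𝓘(ℝ, E →L[ℝ] ℝ)) p) :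
    ∃ (f : M → ℝ) (X : VField I M), SmoothFun I f ∧ SmoothVField I X ∧
      Φ = mvfderiv (I.prod 𝓘(ℝ, E →L[ℝ] ℝ)) (lift I f) p
        + mvfderiv (I.prod 𝓘(ℝ, E →L[ℝ] ℝ)) (momentum I X) p := by
  obtain ⟨_, ⟨f, X, hf, hX, rfl⟩, h⟩ := hasCoordFunctions_affineFunctions p
    (Φ.comp (ofCoord (I.prod 𝓘(ℝ, E →L[ℝ] ℝ)) p p))
  refine ⟨f, X, hf, hX, ?_⟩
  rw [← mvfderiv_lift_add_momentum hf hX, (mvfderiv_coordFunction h).self_of_nhds]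
  ext V
  exact (congrArg Φ (ofCoord_toCoord (mem_chart_source _ p) V)).symm

omit [FiniteDimensional ℝ E] [I.Boundaryless] in
theorem bracket_affineFunctions
    (W : Tensor2 (I.prod 𝓘(ℝ, E →L[ℝ] ℝ)) (CotangentBundle I M)) {f g : M → ℝ}
    {X Y : VField I M} (hf : SmoothFun I f) (hg : SmoothFun I g) (hX : SmoothVField I X)
    (hY : SmoothVField I Y) (p : CotangentBundle I M) :
    bracket (I.prod 𝓘(ℝ, E →L[ℝ] ℝ)) W (fun q => lift I f q + momentum I X q)
        (fun q => lift I g q + momentum I Y q) p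
      = bracket (I.prod 𝓘(ℝ, E →L[ℝ] ℝ)) W (lift I f) (lift I g) p
        + bracket (I.prod 𝓘(ℝ, E →L[ℝ] ℝ)) W (lift I f) (momentum I Y) p
        + bracket (I.prod 𝓘(ℝ, E →L[ℝ] ℝ)) W (momentum I X) (lift I g) p
        + bracket (I.prod 𝓘(ℝ, E →L[ℝ] ℝ)) W (momentum I X) (momentum I Y) p := by
  simp only [bracket]
  rw [mvfderiv_lift_add_momentum hf hX, mvfderiv_lift_add_momentum hg hY]
  simp only [map_add, LinearMap.add_apply]
  ring

theorem smoothTensorAt_canonicalPoisson [T2Space M] (p : CotangentBundle I M) :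
    SmoothTensorAt (I.prod 𝓘(ℝ, E →L[ℝ] ℝ)) (canonicalPoisson I) p := by
  refine smoothTensorAt_of_coordFunctions (hasCoordFunctions_affineFunctions p) ?_
  rintro _ ⟨f, X, hf, hX, rfl⟩ _ ⟨g, Y, hg, hY, rfl⟩
  have h : bracket (I.prod 𝓘(ℝ, E →L[ℝ] ℝ)) (canonicalPoisson I)
      (fun q => lift I f q + momentum I X q) (fun q => lift I g q + momentum I Y q)
      = fun p => lift I (fun y => mvfderiv I g y (X y)) p - lift I (fun y => mvfderiv I f y (Y y)) p
        + momentum I (mlieBracket I X Y) p := by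
    funext q
    have hX' := smoothVField_iff.1 hX q.1
    have hY' := smoothVField_iff.1 hY q.1
    have h1 : bracket (I.prod 𝓘(ℝ, E →L[ℝ] ℝ)) (canonicalPoisson I) (lift I f) (momentum I Y) q
      = -bracket (I.prod 𝓘(ℝ, E →L[ℝ] ℝ)) (canonicalPoisson I) (momentum I Y) (lift I f) q :=
      canonicalPoisson_skew q _ _
    rw [bracket_affineFunctions _ hf hg hX hY, h1,
      bracket_canonicalPoisson_lift_lift (hf q.1) (hg q.1),
      bracket_canonicalPoisson_momentum_lift hX' (hg q.1),
      bracket_canonicalPoisson_momentum_lift hY' (hf q.1),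
      bracket_canonicalPoisson_momentum_momentum hX' hY']
    simp only [lift]
    ring
  rw [h]
  exact ((smoothFun_lift (smoothFun_mvfderiv_apply hg hX)).sub
    (smoothFun_lift (smoothFun_mvfderiv_apply hf hY))).add
    (smoothFun_momentum (smoothVField_mlieBracket hX hY)) p

end CanonicalPoisson

section Lift

variable {E : Type*} [NormedAddCommGroup E] [NormedSpace ℝ E] [FiniteDimensional ℝ E]
  {H : Type*} [TopologicalSpace H] {I : ModelWithCorners ℝ E H} [I.Boundaryless]
  {M : Type*} [TopologicalSpace M] [ChartedSpace H M] [IsManifold I ∞ M]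
  {w : Tensor2 I M} (nabla : CovariantDerivative I E (TangentSpace I : M → Type _))

/-! ### The vector field `K` -/

omit [I.Boundaryless] in
theorem apply_fieldK (p : CotangentBundle I M) (Φ : Cotangent (I.prod 𝓘(ℝ, E →L[ℝ] ℝ)) p) :
    Φ (fieldK I w nabla p) = Φ (baseVec I p (toCoord I p.1 p.1 (sharp (w p.1) p.2)))
      + Φ (fiberVec I p (((p.2 : Cotangent I p.1).comp
        (christoffel I nabla p.1 (sharp (w p.1) p.2))).comp (ofCoord I p.1 p.1))) :=
  ContinuousLinearMap.map_add Φ _ _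

theorem mvfderiv_lift_fieldK {f : M → ℝ} (hf : SmoothFun I f) (p : CotangentBundle I M) :
    mvfderiv (I.prod 𝓘(ℝ, E →L[ℝ] ℝ)) (lift I f) p (fieldK I w nabla p)
      = mvfderiv I f p.1 (sharp (w p.1) p.2) := by
  have h0 := mdifferentiableAt_of_contMDiffAt (hf p.1)
  rw [apply_fieldK]
  exact (congrArg₂ (fun a b : ℝ => a + b) (mvfderiv_comp_proj_baseVec h0 _)
    (mvfderiv_comp_proj_fiberVec h0 _)).trans (add_zero _)

theorem mvfderiv_lift_fieldK_eq_momentum (hw : IsBivectorField I w) {f : M → ℝ}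
    (hf : SmoothFun I f) :
    (fun p => mvfderiv (I.prod 𝓘(ℝ, E →L[ℝ] ℝ)) (lift I f) p (fieldK I w nabla p))
      = -momentum I (fun x => sharp (w x) (mvfderiv I f x)) := by
  funext p
  rw [mvfderiv_lift_fieldK nabla hf, apply_sharp, hw.skew, Pi.neg_apply, momentum]
  exact congrArg Neg.neg (apply_sharp (w p.1) (mvfderiv I f p.1) p.2).symm

theorem mvfderiv_momentum_fieldK {X : VField I M} (hX : SmoothVField I X) :
    (fun p => mvfderiv (I.prod 𝓘(ℝ, E →L[ℝ] ℝ)) (momentum I X) p (fieldK I w nabla p))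
      = quad I (symD I w nabla X) := by
  funext p
  have hX' := smoothVField_iff.1 hX p.1
  have h1 : quad I (symD I w nabla X) p = p.2 (nabla X p.1 (sharp (w p.1) p.2)) := by
    simp only [quad, symD, LinearMap.mk₂_apply]
    ring
  rw [h1, nabla_eq_jacobian_add_christoffel nabla hX', map_add, apply_fieldK]
  refine congrArg₂ (fun a b : ℝ => a + b) (mvfderiv_momentum_baseVec hX' _)
    ((mvfderiv_momentum_fiberVec hX' _).trans ?_)
  exact congrArg (fun v => p.2 (christoffel I nabla p.1 (sharp (w p.1) p.2) v))
    (ofCoord_toCoord (mem_chart_source H p.1) (X p.1))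

variable [T2Space M] [CovariantDerivative.ContMDiffCovariantDerivative nabla ∞]

theorem smoothTensorAt_symD (hw : IsBivectorField I w) {X : VField I M} (hX : SmoothVField I X)
    (x : M) : SmoothTensorAt I (symD I w nabla X) x := by
  refine smoothTensorAt_of_bracket (fun f g hf hg => ?_) x
  have hs : ∀ f : M → ℝ, SmoothFun I f →
      SmoothVField I (fun x => sharp (w x) (mvfderiv I f x)) := fun f hf =>
    smoothVField_sharp hw fun x => smoothFormAt_mvfderiv (hf x)
  exact contMDiff_const.mul
    ((smoothFun_mvfderiv_apply hg (smoothVField_nabla nabla hX (hs f hf))).add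
      (smoothFun_mvfderiv_apply hf (smoothVField_nabla nabla hX (hs g hg))))

theorem smoothFieldAt_fieldK (hw : IsBivectorField I w) (p : CotangentBundle I M) :
    SmoothFieldAt (I.prod 𝓘(ℝ, E →L[ℝ] ℝ)) (fieldK I w nabla) p := by
  refine smoothFieldAt_of_coordFunctions (hasCoordFunctions_affineFunctions p) ?_
  rintro _ ⟨f, X, hf, hX, rfl⟩
  have h : (fun q => mvfderiv (I.prod 𝓘(ℝ, E →L[ℝ] ℝ)) (fun q => lift I f q + momentum I X q) q
      (fieldK I w nabla q)) = fun q => (-momentum I (fun x => sharp (w x) (mvfderiv I f x))) q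
        + quad I (symD I w nabla X) q := by
    rw [← mvfderiv_lift_fieldK_eq_momentum nabla hw hf, ← mvfderiv_momentum_fieldK nabla hX]
    funext q
    rw [mvfderiv_lift_add_momentum hf hX]
    rfl
  rw [h]
  have hs : SmoothVField I (fun x => sharp (w x) (mvfderiv I f x)) :=
    smoothVField_sharp hw fun x => smoothFormAt_mvfderiv (hf x)
  exact ((smoothFun_momentum hs p).neg).add (contMDiffAt_quad (smoothTensorAt_symD nabla hw hX p.1))

/-! ### The graded lift -/

theorem bracket_gradedLift (hw : IsBivectorField I w) {F G : CotangentBundle I M → ℝ}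
    (hF : SmoothFun (I.prod 𝓘(ℝ, E →L[ℝ] ℝ)) F) (hG : SmoothFun (I.prod 𝓘(ℝ, E →L[ℝ] ℝ)) G)
    (p : CotangentBundle I M) :
    bracket (I.prod 𝓘(ℝ, E →L[ℝ] ℝ)) (gradedLift I w nabla) F G p
      = (1 / 2 : ℝ) *
        (mvfderiv (I.prod 𝓘(ℝ, E →L[ℝ] ℝ))
            (bracket (I.prod 𝓘(ℝ, E →L[ℝ] ℝ)) (canonicalPoisson I) F G) p (fieldK I w nabla p)
          - bracket (I.prod 𝓘(ℝ, E →L[ℝ] ℝ)) (canonicalPoisson I) (fun q =>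
              mvfderiv (I.prod 𝓘(ℝ, E →L[ℝ] ℝ)) F q (fieldK I w nabla q)) G p
          - bracket (I.prod 𝓘(ℝ, E →L[ℝ] ℝ)) (canonicalPoisson I) F (fun q =>
              mvfderiv (I.prod 𝓘(ℝ, E →L[ℝ] ℝ)) G q (fieldK I w nabla q)) p) := by
  rw [← lieDeriv_apply_mvfderiv (smoothTensorAt_canonicalPoisson p)
    (smoothFieldAt_fieldK nabla hw p) (hF p) (hG p)]
  rfl

theorem isBivectorField_gradedLift (hw : IsBivectorField I w) :
    IsBivectorField (I.prod 𝓘(ℝ, E →L[ℝ] ℝ)) (gradedLift I w nabla) where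
  skew p Φ Ψ := by
    obtain ⟨f, X, hf, hX, rfl⟩ := exists_covector_eq p Φ
    obtain ⟨g, Y, hg, hY, rfl⟩ := exists_covector_eq p Ψ
    rw [← mvfderiv_lift_add_momentum hf hX, ← mvfderiv_lift_add_momentum hg hY]
    have hF := (smoothFun_lift hf).add (smoothFun_momentum hX)
    have hG := (smoothFun_lift hg).add (smoothFun_momentum hY)
    have h1 := bracket_gradedLift nabla hw hF hG p
    have h2 := bracket_gradedLift nabla hw hG hF p
    have hs : ∀ F G : CotangentBundle I M → ℝ,
        bracket (I.prod 𝓘(ℝ, E →L[ℝ] ℝ)) (canonicalPoisson I) F G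
          = -bracket (I.prod 𝓘(ℝ, E →L[ℝ] ℝ)) (canonicalPoisson I) G F :=
      fun F G => funext fun q => canonicalPoisson_skew q _ _
    have k1 := fun F G => congrFun (hs F G) p
    rw [hs _ (lift I g + momentum I Y), mvfderiv_neg, k1 _ (lift I g + momentum I Y),
      k1 (lift I f + momentum I X) (fun q => mvfderiv _ (lift I g + momentum I Y) q _)] at h1
    refine h1.trans ((?_ : _ = _).trans (congrArg Neg.neg h2).symm)
    simp only [Pi.neg_apply, _root_.neg_apply]
    ring
  smooth F G hF hG := by
    have hK : ∀ F : CotangentBundle I M → ℝ, SmoothFun (I.prod 𝓘(ℝ, E →L[ℝ] ℝ)) F →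
        SmoothFun (I.prod 𝓘(ℝ, E →L[ℝ] ℝ)) (fun q =>
          mvfderiv (I.prod 𝓘(ℝ, E →L[ℝ] ℝ)) F q (fieldK I w nabla q)) := fun F hF p =>
      contMDiffAt_mvfderiv_apply (hF p) (smoothFieldAt_fieldK nabla hw p)
    have hB : ∀ F G : CotangentBundle I M → ℝ, SmoothFun (I.prod 𝓘(ℝ, E →L[ℝ] ℝ)) F →
        SmoothFun (I.prod 𝓘(ℝ, E →L[ℝ] ℝ)) G → SmoothFun (I.prod 𝓘(ℝ, E →L[ℝ] ℝ))
          (bracket (I.prod 𝓘(ℝ, E →L[ℝ] ℝ)) (canonicalPoisson I) F G) := fun F G hF hG p =>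
      contMDiffAt_bracket (smoothTensorAt_canonicalPoisson p) (hF p) (hG p)
    rw [funext (bracket_gradedLift nabla hw hF hG)]
    exact contMDiff_const.mul (((hK _ (hB F G hF hG)).sub (hB _ G (hK F hF) hG)).sub
      (hB F _ hF (hK G hG)))

omit [T2Space M] [CovariantDerivative.ContMDiffCovariantDerivative nabla ∞]
  [FiniteDimensional ℝ E] [I.Boundaryless] in
theorem bracket_neg_right {W : Tensor2 (I.prod 𝓘(ℝ, E →L[ℝ] ℝ)) (CotangentBundle I M)}
    (F G : CotangentBundle I M → ℝ) (p : CotangentBundle I M) :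
    bracket (I.prod 𝓘(ℝ, E →L[ℝ] ℝ)) W F (-G) p
      = -bracket (I.prod 𝓘(ℝ, E →L[ℝ] ℝ)) W F G p := by
  simp only [bracket, mvfderiv_neg, map_neg]

omit [T2Space M] [CovariantDerivative.ContMDiffCovariantDerivative nabla ∞]
  [FiniteDimensional ℝ E] [I.Boundaryless] in
theorem bracket_neg_left {W : Tensor2 (I.prod 𝓘(ℝ, E →L[ℝ] ℝ)) (CotangentBundle I M)}
    (F G : CotangentBundle I M → ℝ) (p : CotangentBundle I M) :
    bracket (I.prod 𝓘(ℝ, E →L[ℝ] ℝ)) W (-F) G p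
      = -bracket (I.prod 𝓘(ℝ, E →L[ℝ] ℝ)) W F G p := by
  simp only [bracket, mvfderiv_neg, map_neg, LinearMap.neg_apply]

theorem baseBracket_gradedLift (hw : IsBivectorField I w) :
    BaseBracket I w (gradedLift I w nabla) := by
  intro f g hf hg
  funext p
  have hs : ∀ f : M → ℝ, SmoothFun I f →
      SmoothVField I (fun x => sharp (w x) (mvfderiv I f x)) := fun f hf =>
    smoothVField_sharp hw fun x => smoothFormAt_mvfderiv (hf x)
  have h0 : bracket (I.prod 𝓘(ℝ, E →L[ℝ] ℝ)) (canonicalPoisson I) (lift I f) (lift I g)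
      = fun _ => 0 := funext fun q => bracket_canonicalPoisson_lift_lift (hf q.1) (hg q.1)
  have h1 : bracket (I.prod 𝓘(ℝ, E →L[ℝ] ℝ)) (canonicalPoisson I) (lift I f)
      (momentum I fun x => sharp (w x) (mvfderiv I g x)) p
      = -bracket (I.prod 𝓘(ℝ, E →L[ℝ] ℝ)) (canonicalPoisson I)
        (momentum I fun x => sharp (w x) (mvfderiv I g x)) (lift I f) p :=
    canonicalPoisson_skew p _ _
  rw [bracket_gradedLift nabla hw (smoothFun_lift hf) (smoothFun_lift hg),
    mvfderiv_lift_fieldK_eq_momentum nabla hw hf, mvfderiv_lift_fieldK_eq_momentum nabla hw hg,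
    bracket_neg_left, bracket_neg_right, h1, h0, (HasVDeriv.const _ _).mvfderiv_eq,
    bracket_canonicalPoisson_momentum_lift (smoothVField_iff.1 (hs f hf) p.1) (hg p.1),
    bracket_canonicalPoisson_momentum_lift (smoothVField_iff.1 (hs g hg) p.1) (hf p.1),
    apply_sharp, apply_sharp, hw.skew p.1 (mvfderiv I g p.1), _root_.zero_apply]
  simp only [lift, bracket]
  ring

theorem momentumBracket_gradedLift (hw : IsBivectorField I w) :
    MomentumBracket I w nabla (gradedLift I w nabla) := by
  intro X Y hX hY
  funext p
  have hX' := smoothVField_iff.1 hX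
  have hY' := smoothVField_iff.1 hY
  have h0 : bracket (I.prod 𝓘(ℝ, E →L[ℝ] ℝ)) (canonicalPoisson I) (momentum I X) (momentum I Y)
      = momentum I (mlieBracket I X Y) :=
    funext fun q => bracket_canonicalPoisson_momentum_momentum (hX' q.1) (hY' q.1)
  have h1 : bracket (I.prod 𝓘(ℝ, E →L[ℝ] ℝ)) (canonicalPoisson I) (quad I (symD I w nabla X))
      (momentum I Y) p = -bracket (I.prod 𝓘(ℝ, E →L[ℝ] ℝ)) (canonicalPoisson I)
        (momentum I Y) (quad I (symD I w nabla X)) p := canonicalPoisson_skew p _ _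
  have h2 := congrFun (mvfderiv_momentum_fieldK (w := w) nabla (smoothVField_mlieBracket hX hY)) p
  rw [bracket_gradedLift nabla hw (smoothFun_momentum hX) (smoothFun_momentum hY),
    mvfderiv_momentum_fieldK nabla hX, mvfderiv_momentum_fieldK nabla hY, h1, h0, h2,
    bracket_canonicalPoisson_momentum_quad (hX' p.1) (smoothTensorAt_symD nabla hw hY p.1),
    bracket_canonicalPoisson_momentum_quad (hY' p.1) (smoothTensorAt_symD nabla hw hX p.1)]
  rfl

theorem mixedBracket_gradedLift [CompleteSpace E] (hw : IsBivectorField I w)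
    (ht : nabla.torsion = 0) : MixedBracket I w nabla (gradedLift I w nabla) := by
  intro f X hf hX
  funext p
  obtain ⟨g, hg, hgp⟩ := exists_smoothFun_mvfderiv_eq p.1 (p.2 : Cotangent I p.1)
  have hX' := smoothVField_iff.1 hX
  have hdf : ∀ x, SmoothFormAt I (mvfderiv I f) x := fun x => smoothFormAt_mvfderiv (hf x)
  have hdg : ∀ x, SmoothFormAt I (mvfderiv I g) x := fun x => smoothFormAt_mvfderiv (hg x)
  have hf' := smoothVField_iff.1 (smoothVField_sharp hw hdf)
  have hg' := smoothVField_iff.1 (smoothVField_sharp hw hdg)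
  have h0 : bracket (I.prod 𝓘(ℝ, E →L[ℝ] ℝ)) (canonicalPoisson I) (momentum I X) (lift I f)
      = lift I (fun y => mvfderiv I f y (X y)) :=
    funext fun q => bracket_canonicalPoisson_momentum_lift (hX' q.1) (hf q.1)
  have tf := (CovariantDerivative.torsion_eq_zero_iff nabla).1 ht (hX' p.1).mdifferentiableAt
    (hf' p.1).mdifferentiableAt
  have tg := (CovariantDerivative.torsion_eq_zero_iff nabla).1 ht (hX' p.1).mdifferentiableAt
    (hg' p.1).mdifferentiableAt
  have h1 := mvfderiv_mlieBracket (hf p.1) (hX' p.1) (hg' p.1)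
  rw [← tg, map_sub] at h1
  have h2 := nablaTensor_apply_eq nabla hw hdf hdg p.1 (X p.1)
  rw [hgp] at h1 h2
  have h3 : mvfderiv (I.prod 𝓘(ℝ, E →L[ℝ] ℝ)) (lift I fun y => mvfderiv I f y (X y)) p
      (fieldK I w nabla p) = mvfderiv I (fun y => mvfderiv I f y (X y)) p.1 (sharp (w p.1) p.2) :=
    mvfderiv_lift_fieldK nabla (smoothFun_mvfderiv_apply hf hX) p
  rw [bracket_gradedLift nabla hw (smoothFun_momentum hX) (smoothFun_lift hf),
    mvfderiv_lift_fieldK_eq_momentum nabla hw hf, mvfderiv_momentum_fieldK nabla hX,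
    bracket_neg_right, h0, h3,
    bracket_canonicalPoisson_quad_lift (smoothTensorAt_symD nabla hw hX p.1) (hf p.1),
    bracket_canonicalPoisson_momentum_momentum (hX' p.1) (hf' p.1)]
  simp only [momentum, ← tf, Pi.neg_apply, barD, contraD, map_sub, map_smul, symD,
    LinearMap.mk₂_apply, smul_eq_mul]
  have h4 : p.2 (sharp (nablaTensor I nabla w p.1 (X p.1)) (mvfderiv I f p.1))
      = nablaTensor I nabla w p.1 (X p.1) (mvfderiv I f p.1) p.2 := apply_sharp _ _ _
  rw [h4, h2]
  linarith

omit [I.Boundaryless] [CovariantDerivative.ContMDiffCovariantDerivative nabla ∞] in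
theorem eq_of_brackets {W W' : Tensor2 (I.prod 𝓘(ℝ, E →L[ℝ] ℝ)) (CotangentBundle I M)}
    (hW : IsBivectorField (I.prod 𝓘(ℝ, E →L[ℝ] ℝ)) W)
    (hW' : IsBivectorField (I.prod 𝓘(ℝ, E →L[ℝ] ℝ)) W')
    (h1 : BaseBracket I w W) (h1' : BaseBracket I w W')
    (h2 : MixedBracket I w nabla W) (h2' : MixedBracket I w nabla W')
    (h3 : MomentumBracket I w nabla W) (h3' : MomentumBracket I w nabla W') : W = W' := by
  funext p
  refine LinearMap.ext fun Φ => LinearMap.ext fun Ψ => ?_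
  obtain ⟨f, X, hf, hX, rfl⟩ := exists_covector_eq p Φ
  obtain ⟨g, Y, hg, hY, rfl⟩ := exists_covector_eq p Ψ
  have e1 := congrFun ((h1 f g hf hg).trans (h1' f g hf hg).symm) p
  have e2 := congrFun ((h2 g X hg hX).trans (h2' g X hg hX).symm) p
  have e2' := congrFun ((h2 f Y hf hY).trans (h2' f Y hf hY).symm) p
  have e3 := congrFun ((h3 X Y hX hY).trans (h3' X Y hX hY).symm) p
  simp only [bracket] at e1 e2 e2' e3
  simp only [map_add, LinearMap.add_apply]
  rw [e1, e2, e3, hW.skew p (mvfderiv _ (lift I f) p) (mvfderiv _ (momentum I Y) p),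
    hW'.skew p (mvfderiv _ (lift I f) p) (mvfderiv _ (momentum I Y) p), e2']

end Lift

end GradedLift

end

theorem proposition2p7 {n : ℕ} {M : Type*} [TopologicalSpace M] [T2Space M]
    [ChartedSpace (EuclideanSpace ℝ (Fin n)) M] [IsManifold (𝓡 n) ∞ M]
    (w : GradedLift.Tensor2 (𝓡 n) M) (hw : GradedLift.IsPoisson (𝓡 n) w)
    (nabla : CovariantDerivative (𝓡 n) (EuclideanSpace ℝ (Fin n))
      (TangentSpace (𝓡 n) : M → Type _))
    [CovariantDerivative.ContMDiffCovariantDerivative nabla ∞] :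
    GradedLift.IsContravariantDerivative (𝓡 n) w (GradedLift.barD (𝓡 n) w nabla) ∧
    GradedLift.AreDual (𝓡 n) w (GradedLift.barDForm (𝓡 n) w nabla)
      (GradedLift.barD (𝓡 n) w nabla) ∧
    GradedLift.IsBivectorField ((𝓡 n).prod 𝓘(ℝ, EuclideanSpace ℝ (Fin n) →L[ℝ] ℝ))
      (GradedLift.gradedLift (𝓡 n) w nabla) ∧
    GradedLift.BaseBracket (𝓡 n) w (GradedLift.gradedLift (𝓡 n) w nabla) ∧
    GradedLift.MomentumBracket (𝓡 n) w nabla (GradedLift.gradedLift (𝓡 n) w nabla) ∧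
    (nabla.torsion = 0 →
      ∀ W : GradedLift.Tensor2 ((𝓡 n).prod 𝓘(ℝ, EuclideanSpace ℝ (Fin n) →L[ℝ] ℝ))
          (GradedLift.CotangentBundle (𝓡 n) M),
        GradedLift.IsBivectorField ((𝓡 n).prod 𝓘(ℝ, EuclideanSpace ℝ (Fin n) →L[ℝ] ℝ)) W →
        (W = GradedLift.gradedLift (𝓡 n) w nabla ↔
          GradedLift.BaseBracket (𝓡 n) w W ∧
          GradedLift.MixedBracket (𝓡 n) w nabla W ∧
          GradedLift.MomentumBracket (𝓡 n) w nabla W)) := by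
  have hb := hw.bivector
  have hL := GradedLift.isBivectorField_gradedLift nabla hb
  have h1 := GradedLift.baseBracket_gradedLift nabla hb
  have h3 := GradedLift.momentumBracket_gradedLift nabla hb
  refine ⟨GradedLift.isContravariantDerivative_barD nabla hb,
    GradedLift.areDual_barDForm_barD nabla, hL, h1, h3, fun ht W hW => ⟨?_, ?_⟩⟩
  · rintro rfl
    exact ⟨h1, GradedLift.mixedBracket_gradedLift nabla hb ht, h3⟩
  · rintro ⟨k1, k2, k3⟩
    exact GradedLift.eq_of_brackets nabla hW hL k1 h1 k2
      (GradedLift.mixedBracket_gradedLift nabla hb ht) k3 h3
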